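/- **Setting.** Let $(X,\mathbf d)$ be a metric space of doubling dimension $d$, i.e. $d$ is the smallest real number such that every closed ball of $X$ can be covered by at most $2^d$ closed balls of half its radius. For finite nonempty $A,B\subseteq X$ let $\mathbf d_h(A,B)=\max_{a\in A}\min_{b\in B}\mathbf d(a,b)$. **Greedy trees.** Fix $\alpha>1$. An enumeration $p_0,\dots,p_{m-1}$ of the $m$ distinct points of $A$, with prefixes $P_i=\{p_0,\dots,p_{i-1}\}$, is an *$\alpha$-approximate greedy permutation* if $\mathbf d(p_i,P_i)\ge\frac1\alpha\max_{p\in A}\mathbf d(p,P_i)$ for $1\le i<m$. An *$\alpha$-scaling predecessor map* sends each $p_i$, $i\ge1$, to some $T(p_i)\in P_i$ with $\varepsilon_{p_i}:=\mathbf d(p_i,T(p_i))\le\alpha\,\mathbf d(p_i,P_i)$ and $\varepsilon_{p_i}\le\frac1\alpha\varepsilon_{T(p_i)}$, where $\varepsilon_{p_0}:=\infty$. The resulting *greedy tree on $A$ with parameter $\alpha$* is the binary tree that starts with one leaf centered at $p_0$ and in which, for $i=1,\dots,m-1$, the leaf centered at $q=T(p_i)$ receives a left child centered at $q$ and a right child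 centered at $p_i$. The radius $\mathrm{rad}(x)$ of a node $x$ is the distance from its center to the farthest center of a leaf below it. Write $\mathbf d_{\mathrm{ctr}}(x,y)$ for the distance between the centers of $x$ and $y$. **Input.** Greedy trees $G_A,G_B$ with parameter $\alpha$ on $A$ and $B$, with the radii stored at the nodes; a real $\varepsilon>0$; and a list of nodes output by a simultaneous radius-order traversal of the two trees: start with a heap holding the two roots and, as long as the heap holds a node of nonzero radius, remove a node of largest radius (ties broken arbitrarily), append it to the list, and put its two children into the heap. **Algorithm Hausdorff.** Maintain a bipartite graph $N$ between nodes of $G_A$ and nodes of $G_B$, with neighbourhoods $N(\cdot)$, stored by adjacency lists, and a number $L$. Initially $N$ is a single edge between the two roots. Updating a node $x$ of $G_A$ means setting $\ell(x):=\max\{\min_{y\in N(x)}(\mathbf d_{\mathrm{ctr}}(x,y)-\mathrm{rad}(y)),0\}$ and $L:=\max\{L,\ell(x)\}$; start with $L=0$ and update the root of $G_A$. For each node $z$ of the list in turn: if $\mathrm{rad}(z)\le\varepsilon L/2$, stop and return $L$. Otherwise replace $z$ in $N$ by its children $z_l,z_r$, both joined to all neighbours of $z$; let $S=\{z_l,z_r\}$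 if $z\in G_A$ and $S=N(z_l)$ if $z\in G_B$; for each $x\in S$ remove every edge $(x,y)$ for which some $y'\in N(x)$ satisfies $\mathbf d_{\mathrm{ctr}}(x,y)-\mathrm{rad}(y)>\mathbf d_{\mathrm{ctr}}(x,y')+2\,\mathrm{rad}(x)$, and then update $x$. When the list is exhausted, return $L$. Time is the number of elementary steps: each call of the distance oracle, operation on or comparison of real numbers, access to memory or to data stored at a node, test, and elementary list operation is one step. (The construction of the trees and of the list is not counted.) **Theorem.** For every $\alpha>1$ there is a constant $C>0$, depending only on $\alpha$, such that for all $X$, $d$, $A$, $B$, $G_A$, $G_B$, lists and $\varepsilon>0$ as above, with $n=|A|+|B|$, the algorithm Hausdorff returns a value $L$ with $$L\le\mathbf d_h(A,B)\le(1+\varepsilon)L$$ after at most $C\left(2+\frac1\varepsilon\right)^{Cd}n$ steps; that is, it runs in $\left(2+\frac1\varepsilon\right)^{O(d)}n$ time. -/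

import Mathlib

universe u v w

/-! ### Doubling dimension and directed Hausdorff distance -/

/-- Every closed ball of `X` can be covered by at most `2 ^ d` closed balls of half its radius. -/
def HalfRadiusCover (X : Type u) [MetricSpace X] (d : ℝ) : Prop :=
  ∀ (c : X) (r : ℝ), 0 ≤ r → ∃ S : Finset X, (S.card : ℝ) ≤ (2 : ℝ) ^ d ∧
    Metric.closedBall c r ⊆ ⋃ s ∈ S, Metric.closedBall s (r / 2)

/-- `d` is the doubling dimension of `X`: the smallest real number with the covering property. -/
def IsDoublingDimension (X : Type u) [MetricSpace X] (d : ℝ) : Prop :=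
  IsLeast {e : ℝ | HalfRadiusCover X e} d

/-- The directed Hausdorff distance `max_{a ∈ A} min_{b ∈ B} dist a b`. -/
noncomputable def directedHausdorff {X : Type u} [MetricSpace X] (A B : Finset X)
    (hA : A.Nonempty) (hB : B.Nonempty) : ℝ :=
  A.sup' hA fun a => B.inf' hB fun b => dist a b

/-! ### Greedy permutations, predecessor maps and greedy trees -/

/-- The distance from `x` to the prefix `{p 0, …, p (i - 1)}`; used for `0 < i` only. -/
noncomputable def prefixDist {X : Type u} [MetricSpace X] (p : ℕ → X) (i : ℕ) (x : X) : ℝ :=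
  Metric.infDist x (p '' Set.Iio i)

/-- `p 0, …, p (|A| - 1)` is an `α`-approximate greedy permutation of `A`. -/
structure IsGreedyPermutation {X : Type u} [MetricSpace X] (α : ℝ) (A : Finset X)
    (p : ℕ → X) : Prop where
  injOn : Set.InjOn p (Set.Iio A.card)
  image_eq : p '' Set.Iio A.card = (A : Set X)
  greedy : ∀ i, 0 < i → i < A.card → ∀ a ∈ A,
    (1 / α) * prefixDist p i a ≤ prefixDist p i (p i)

/-- `p i ↦ p (T i)`, `0 < i < m`, is an `α`-scaling predecessor map for the sequence
`p 0, …, p (m - 1)`: it sends `p i` to an `α`-approximate nearest neighbour in the prefix before it,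
and the insertion distance `dist (p i) (p (T i))` is at most `1 / α` times that of the predecessor
(the insertion distance of `p 0` is infinite). -/
structure IsPredecessorMap {X : Type u} [MetricSpace X] (α : ℝ) (m : ℕ)
    (p : ℕ → X) (T : ℕ → ℕ) : Prop where
  lt : ∀ i, 0 < i → i < m → T i < i
  approx : ∀ i, 0 < i → i < m → dist (p i) (p (T i)) ≤ α * prefixDist p i (p i)
  scaling : ∀ i, 0 < i → i < m → 0 < T i →
    dist (p i) (p (T i)) ≤ (1 / α) * dist (p (T i)) (p (T (T i)))

/-- Binary trees whose nodes carry a center. -/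
inductive BallTree (X : Type u) : Type u
  | leaf (c : X) : BallTree X
  | node (c : X) (l r : BallTree X) : BallTree X

namespace BallTree

/-- The center of the root. -/
def center {X : Type u} : BallTree X → X
  | leaf c => c
  | node c _ _ => c

/-- The largest distance from `a` to a leaf of the tree. -/
noncomputable def maxDist {X : Type u} [MetricSpace X] (a : X) : BallTree X → ℝ
  | leaf c => dist a c
  | node _ l r => max (maxDist a l) (maxDist a r)

/-- The radius of the root: the distance from its center to the farthest leaf. -/
noncomputable def radius {X : Type u} [MetricSpace X] (t : BallTree X) : ℝ :=
  t.maxDist t.center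

open Classical in
/-- Give the leaf centered at `q` a left child centered at `q` and a right child centered at `p`. -/
noncomputable def attach {X : Type u} (q p : X) : BallTree X → BallTree X
  | leaf c => if c = q then node q (leaf q) (leaf p) else leaf c
  | node c l r => node c (attach q p l) (attach q p r)

/-- The tree obtained after inserting `p 0, …, p k`, where `p i` has predecessor `p (T i)`. -/
noncomputable def build {X : Type u} (p : ℕ → X) (T : ℕ → ℕ) : ℕ → BallTree X
  | 0 => leaf (p 0)
  | k + 1 => attach (p (T (k + 1))) (p (k + 1)) (build p T k)

end BallTree

/-- `G` is a greedy tree on `A` with parameter `α`. -/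
def IsGreedyTree {X : Type u} [MetricSpace X] (α : ℝ) (A : Finset X) (G : BallTree X) : Prop :=
  A.Nonempty ∧ ∃ (p : ℕ → X) (T : ℕ → ℕ), IsGreedyPermutation α A p ∧
    IsPredecessorMap α A.card p T ∧ G = BallTree.build p T (A.card - 1)

/-! ### The simultaneous radius-order traversal of two trees -/

/-- Tells whether a node belongs to the tree on `A` or to the tree on `B`. -/
inductive Side : Type
  | inA : Side
  | inB : Side

/-- A node of one of the two greedy trees, given by the subtree below it. The nodes of a greedy
tree have pairwise distinct subtrees, so this determines the node. -/
structure Vertex (X : Type u) : Type u where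
  side : Side
  tree : BallTree X

/-- `RadiusOrder H zs`: the list `zs` is a possible output of the radius-order traversal that starts
with the heap `H`. As long as the heap has a node of nonzero radius, a node of largest radius is
removed from the heap, appended to the output, and replaced by its two children. -/
inductive RadiusOrder {X : Type u} [MetricSpace X] :
    Multiset (Vertex X) → List (Vertex X) → Prop
  | done (H : Multiset (Vertex X)) (h : ∀ v ∈ H, v.tree.radius = 0) : RadiusOrder H []
  | pop (H : Multiset (Vertex X)) (s : Side) (c : X) (l r : BallTree X) (zs : List (Vertex X))
      (hpos : (BallTree.node c l r).radius ≠ 0)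
      (hmax : ∀ v ∈ H, v.tree.radius ≤ (BallTree.node c l r).radius)
      (h : RadiusOrder (⟨s, l⟩ ::ₘ ⟨s, r⟩ ::ₘ H) zs) :
      RadiusOrder (⟨s, BallTree.node c l r⟩ ::ₘ H) (⟨s, BallTree.node c l r⟩ :: zs)

/-! ### The machine: a unit-cost real RAM with a distance oracle -/

/-- The memory: the adjacency lists of the viability graph, the local lower bounds, and the global
lower bound. -/
structure Memory (X : Type u) : Type u where
  adj : Vertex X → List (Vertex X)
  low : Vertex X → ℝ
  best : ℝ

/-- A computation takes a memory to a result, a new memory and the number of executed steps. -/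
def Comp (X : Type u) (β : Type v) : Type (max u v) :=
  Memory X → β × Memory X × ℕ

namespace Comp

/-- Return a value that is already at hand. -/
def ret {X : Type u} {β : Type v} (b : β) : Comp X β := fun M => (b, M, 0)

/-- Sequential composition; the numbers of steps add up. -/
def bind {X : Type u} {β : Type v} {γ : Type w} (m : Comp X β) (f : β → Comp X γ) : Comp X γ :=
  fun M => ((f (m M).1 (m M).2.1).1, (f (m M).1 (m M).2.1).2.1,
    (m M).2.2 + (f (m M).1 (m M).2.1).2.2)

/-- One elementary step. -/
def instr {X : Type u} {β : Type v} (f : Memory X → β × Memory X) : Comp X β :=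
  fun M => ((f M).1, (f M).2, 1)

/-- One elementary step that does not change the memory. -/
def query {X : Type u} {β : Type v} (b : β) : Comp X β := instr fun M => (b, M)

end Comp

infixl:55 " ≫= " => Comp.bind

namespace Hausdorff

open Comp

/-! Elementary steps. Every access to the memory or to the data stored at a node (side, center,
radius, children), every call of the distance oracle, every operation on real numbers, every test
and every list operation (taking a list apart, prepending an element) is one step. -/

/-- Taking a list apart. -/
def tick {X : Type u} : Comp X Unit := query ()

def getSide {X : Type u} (v : Vertex X) : Comp X Side := query v.side

def getCenter {X : Type u} (v : Vertex X) : Comp X X := query v.tree.center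

/-- The radii are stored with the nodes. -/
noncomputable def getRadius {X : Type u} [MetricSpace X] (v : Vertex X) : Comp X ℝ :=
  query v.tree.radius

def getChildren {X : Type u} (v : Vertex X) : Comp X (Option (Vertex X × Vertex X)) :=
  query (match v.tree with
    | .leaf _ => none
    | .node _ l r => some (⟨v.side, l⟩, ⟨v.side, r⟩))

noncomputable def distance {X : Type u} [MetricSpace X] (a b : X) : Comp X ℝ := query (dist a b)

noncomputable def add {X : Type u} (a b : ℝ) : Comp X ℝ := query (a + b)

noncomputable def sub {X : Type u} (a b : ℝ) : Comp X ℝ := query (a - b)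

noncomputable def mul {X : Type u} (a b : ℝ) : Comp X ℝ := query (a * b)

noncomputable def half {X : Type u} (a : ℝ) : Comp X ℝ := query (a / 2)

noncomputable def minimum {X : Type u} (a b : ℝ) : Comp X ℝ := query (min a b)

noncomputable def maximum {X : Type u} (a b : ℝ) : Comp X ℝ := query (max a b)

open Classical in
noncomputable def lessThan {X : Type u} (a b : ℝ) : Comp X Bool := query (decide (a < b))

open Classical in
noncomputable def atMost {X : Type u} (a b : ℝ) : Comp X Bool := query (decide (a ≤ b))

open Classical in
noncomputable def same {X : Type u} (v w : Vertex X) : Comp X Bool := query (decide (v = w))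

def prepend {X : Type u} (v : Vertex X) (l : List (Vertex X)) : Comp X (List (Vertex X)) :=
  query (v :: l)

def getAdj {X : Type u} (v : Vertex X) : Comp X (List (Vertex X)) := instr fun M => (M.adj v, M)

open Classical in
noncomputable def setAdj {X : Type u} (v : Vertex X) (l : List (Vertex X)) : Comp X Unit :=
  instr fun M => ((), { M with adj := Function.update M.adj v l })

open Classical in
noncomputable def setLow {X : Type u} (v : Vertex X) (a : ℝ) : Comp X Unit :=
  instr fun M => ((), { M with low := Function.update M.low v a })

def getBest {X : Type u} : Comp X ℝ := instr fun M => (M.best, M)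

def setBest {X : Type u} (a : ℝ) : Comp X Unit := instr fun M => ((), { M with best := a })

/-! The program. -/

/-- Run `f` on every element of a list. -/
def forEach {X : Type u} (f : Vertex X → Comp X Unit) : List (Vertex X) → Comp X Unit
  | [] => tick
  | v :: vs => tick ≫= fun _ => f v ≫= fun _ => forEach f vs

/-- The minimum of the values of `f` on a nonempty list. -/
noncomputable def minOver {X : Type u} (f : Vertex X → Comp X ℝ) : List (Vertex X) → Comp X ℝ
  | [] => tick ≫= fun _ => ret 0
  | [v] => tick ≫= fun _ => f v
  | v :: v' :: vs => tick ≫= fun _ => f v ≫= fun a =>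
      minOver f (v' :: vs) ≫= fun b => minimum a b

/-- Delete `x` from a list. -/
noncomputable def deleteFrom {X : Type u} (x : Vertex X) :
    List (Vertex X) → Comp X (List (Vertex X))
  | [] => tick ≫= fun _ => ret []
  | v :: vs => tick ≫= fun _ => same v x ≫= fun e =>
      if e then deleteFrom x vs
      else deleteFrom x vs ≫= fun vs' => prepend v vs'

/-- The distance between the centers of two nodes. -/
noncomputable def centerDist {X : Type u} [MetricSpace X] (x y : Vertex X) : Comp X ℝ :=
  getCenter x ≫= fun a => getCenter y ≫= fun b => distance a b

/-- The distance between the centers of `x` and `y` minus the radius of `y`. -/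
noncomputable def gap {X : Type u} [MetricSpace X] (x y : Vertex X) : Comp X ℝ :=
  centerDist x y ≫= fun a => getRadius y ≫= fun ρ => sub a ρ

/-- `ℓ(x) := max (min_{y ∈ N(x)} (centerDist x y - radius y)) 0` and `L := max L ℓ(x)`. -/
noncomputable def updateLow {X : Type u} [MetricSpace X] (x : Vertex X) : Comp X Unit :=
  getAdj x ≫= fun ys => minOver (gap x) ys ≫= fun m => maximum m 0 ≫= fun a =>
    setLow x a ≫= fun _ => getBest ≫= fun b => maximum b a ≫= fun b' => setBest b'

/-- Remove the edge between `x` and each listed `y` with `centerDist x y - radius y > t`; the result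
is the list of the `y` that are kept. -/
noncomputable def pruneAbove {X : Type u} [MetricSpace X] (x : Vertex X) (t : ℝ) :
    List (Vertex X) → Comp X (List (Vertex X))
  | [] => tick ≫= fun _ => ret []
  | y :: ys => tick ≫= fun _ => gap x y ≫= fun g => lessThan t g ≫= fun e =>
      if e then
        getAdj y ≫= fun xs => deleteFrom x xs ≫= fun xs' => setAdj y xs' ≫= fun _ =>
          pruneAbove x t ys
      else pruneAbove x t ys ≫= fun ys' => prepend y ys'

/-- Prune `x`: remove every edge `(x, y)` for which some `y' ∈ N(x)` satisfies
`centerDist x y - radius y > centerDist x y' + 2 * radius x`. -/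
noncomputable def prune {X : Type u} [MetricSpace X] (x : Vertex X) : Comp X Unit :=
  getAdj x ≫= fun ys => minOver (centerDist x) ys ≫= fun m => getRadius x ≫= fun ρ =>
    add ρ ρ ≫= fun ρ2 => add m ρ2 ≫= fun t => pruneAbove x t ys ≫= fun ys' => setAdj x ys'

/-- In the adjacency list of `v`, replace `z` by its children. -/
noncomputable def replaceIn {X : Type u} (z zl zr v : Vertex X) : Comp X Unit :=
  getAdj v ≫= fun ws => deleteFrom z ws ≫= fun ws' => prepend zr ws' ≫= fun ws₁ =>
    prepend zl ws₁ ≫= fun ws₂ => setAdj v ws₂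

/-- Replace `z` by its children in the viability graph, joining them to all the neighbours of `z`;
the result is the list of the neighbours. -/
noncomputable def splitVertex {X : Type u} (z zl zr : Vertex X) : Comp X (List (Vertex X)) :=
  getAdj z ≫= fun ns => setAdj zl ns ≫= fun _ => setAdj zr ns ≫= fun _ =>
    forEach (replaceIn z zl zr) ns ≫= fun _ => setAdj z [] ≫= fun _ => ret ns

/-- The nodes to be pruned after `z` has been split. -/
def affected {X : Type u} (z zl zr : Vertex X) (ns : List (Vertex X)) :
    Comp X (List (Vertex X)) :=
  getSide z ≫= fun s =>
    match s with
    | .inA => prepend zr [] ≫= fun l => prepend zl l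
    | .inB => ret ns

/-- The main loop. -/
noncomputable def mainLoop {X : Type u} [MetricSpace X] (ε : ℝ) : List (Vertex X) → Comp X ℝ
  | [] => tick ≫= fun _ => getBest
  | z :: zs => tick ≫= fun _ => getRadius z ≫= fun r => getBest ≫= fun L =>
      mul ε L ≫= fun a => half a ≫= fun t => atMost r t ≫= fun finished =>
        if finished then ret L
        else getChildren z ≫= fun ch =>
          match ch with
          | none => ret L
          | some (zl, zr) =>
            splitVertex z zl zr ≫= fun ns => affected z zl zr ns ≫= fun S =>
              forEach (fun x => prune x ≫= fun _ => updateLow x) S ≫= fun _ =>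
                mainLoop ε zs

/-- The whole algorithm. The input consists of the two trees, of the list `zs` of their
nodes in the order of the simultaneous radius-order traversal, and of `ε`. -/
noncomputable def program {X : Type u} [MetricSpace X] (ε : ℝ) (GA GB : BallTree X)
    (zs : List (Vertex X)) : Comp X ℝ :=
  prepend ⟨.inB, GB⟩ [] ≫= fun ys => setAdj ⟨.inA, GA⟩ ys ≫= fun _ =>
    prepend ⟨.inA, GA⟩ [] ≫= fun xs => setAdj ⟨.inB, GB⟩ xs ≫= fun _ =>
      setBest 0 ≫= fun _ => updateLow ⟨.inA, GA⟩ ≫= fun _ => mainLoop ε zs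

/-- The memory before the start. -/
def blank (X : Type u) : Memory X := ⟨fun _ => [], fun _ => 0, 0⟩

/-- The value returned by the algorithm. -/
noncomputable def output {X : Type u} [MetricSpace X] (ε : ℝ) (GA GB : BallTree X)
    (zs : List (Vertex X)) : ℝ :=
  (program ε GA GB zs (blank X)).1

/-- The number of steps executed by the algorithm. -/
noncomputable def runningTime {X : Type u} [MetricSpace X] (ε : ℝ) (GA GB : BallTree X)
    (zs : List (Vertex X)) : ℕ :=
  (program ε GA GB zs (blank X)).2.2

end Hausdorff

/-! ### Covering and packing in doubling spaces -/

/-! Correctness rests on two facts about the viability graph. First, for every point `a` below a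
node `x` of the tree on `A`, each nearest point of `B` stays below some neighbour of `x`
(`GraphInv.cover`): by the triangle inequality an edge that leads to a nearest point never meets the
pruning condition. Hence `ℓ(x)` is at most the distance from the center of `x` to `B`, so `L` is a
lower bound. Second, each node on the `A` side has a neighbour whose gap is at most `L`; if all
current radii are at most `r`, every point of `A` is therefore within `L + 2 * r` of `B`. The loop
stops when `r ≤ ε * L / 2` or when all radii vanish, and then this is at most `(1 + ε) * L`.

The running time rests on a packing argument. Put `κ = α ^ 3 / (α - 1)`. A leaf below a node with
center `c` and right child centered at `p i` is reached from `c` by predecessor steps; the first is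
at most `α ^ 2` times the distance from `p i` to its prefix, and later ones shrink by `1 / α`.
Summing the geometric series, the radius of the node is at most `κ` times that distance (`Tracked`,
`Spread`). Since nodes are split in radius order, the centers in the heap on either side remain `r /
(2 * κ)`-separated while the largest radius is `r` (`HeapInv`). The factor 2 appears because a child
may have a larger radius than its parent: it is the diameters that are monotone.

Pruning and the bound on `L` put all neighbours of a node within `L + 4 * r` of it, and `L < 2 * r /
ε` as long as the loop has not stopped. A doubling space holds at most `(16 * κ * (2 + 1 / ε)) ^ d`
such centers, which bounds all degrees (`GraphInv.length_adj_le`). One iteration costs a cubic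
polynomial in the degree bound, and there are fewer than `n` iterations. -/

theorem HalfRadiusCover.exists_cover {X : Type u} [MetricSpace X] {d : ℝ}
    (h : HalfRadiusCover X d) (k : ℕ) (c : X) (r : ℝ) (hr : 0 ≤ r) :
    ∃ S : Finset X, (S.card : ℝ) ≤ ((2 : ℝ) ^ d) ^ k ∧
      Metric.closedBall c r ⊆ ⋃ s ∈ S, Metric.closedBall s (r / 2 ^ k) := by
  classical
  induction k with
  | zero => exact ⟨{c}, by simp, by simp⟩
  | succ k ih =>
    obtain ⟨S, hS, hcov⟩ := ih
    choose F hF hFc using fun s => h s (r / 2 ^ k) (by positivity)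
    refine ⟨S.biUnion F, ?_, ?_⟩
    · calc ((S.biUnion F).card : ℝ) ≤ ∑ s ∈ S, ((F s).card : ℝ) := by
            exact_mod_cast Finset.card_biUnion_le
        _ ≤ ∑ _s ∈ S, (2 : ℝ) ^ d := Finset.sum_le_sum fun s _ => hF s
        _ = S.card * (2 : ℝ) ^ d := by simp
        _ ≤ ((2 : ℝ) ^ d) ^ k * (2 : ℝ) ^ d := by gcongr
        _ = _ := (pow_succ _ _).symm
    · intro x hx
      obtain ⟨s, hs, hxs⟩ := Set.mem_iUnion₂.1 (hcov hx)
      obtain ⟨t, ht, hxt⟩ := Set.mem_iUnion₂.1 (hFc s hxs)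
      refine Set.mem_iUnion₂.2 ⟨t, Finset.mem_biUnion.2 ⟨s, hs, ht⟩, ?_⟩
      rwa [pow_succ, ← div_div]

/-- The number of points in a ball of radius `r` with pairwise distances at least `s`. -/
theorem HalfRadiusCover.card_le_of_separated {X : Type u} [MetricSpace X] {d : ℝ}
    (h : HalfRadiusCover X d) (hd : 0 ≤ d) {S : Finset X} {c : X} {r s q : ℝ} (hr : 0 ≤ r)
    (hs : 0 < s) (hq : 1 ≤ 2 * q) (hrs : r ≤ q * s) (hS : ∀ x ∈ S, dist x c ≤ r)
    (hsep : ∀ x ∈ S, ∀ y ∈ S, x ≠ y → s ≤ dist x y) : (S.card : ℝ) ≤ (4 * q) ^ d := by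
  classical
  -- With `2 ^ k ≤ 2 * q < 2 ^ (k + 1)`, after `k + 1` halvings the radius is below `s / 2`, so no
  -- covering ball holds two separated points, while `2 ^ (k + 1) ≤ 4 * q` bounds the number of
  -- balls.
  obtain ⟨k, hk, hk'⟩ := exists_nat_pow_near hq (one_lt_two : (1 : ℝ) < 2)
  obtain ⟨F, hF, hcov⟩ := h.exists_cover (k + 1) c r hr
  have hex : ∀ x ∈ S, ∃ f ∈ F, dist x f ≤ r / 2 ^ (k + 1) := fun x hx => by
    simpa using hcov (Metric.mem_closedBall.2 (hS x hx))
  choose! f hfF hfd using hex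
  have hcard : S.card ≤ F.card := by
    refine Finset.card_le_card_of_injOn f hfF fun x hx y hy hxy => ?_
    by_contra hne
    have h1 := hsep x hx y hy hne
    have h2 := hfd x hx
    have h3 := hfd y hy
    rw [← hxy] at h3
    have h4 := dist_triangle_right x y (f x)
    have h5 : r / 2 ^ (k + 1) < s / 2 := by
      rw [div_lt_div_iff₀ (by positivity) two_pos]
      nlinarith
    linarith
  calc (S.card : ℝ) ≤ F.card := by exact_mod_cast hcard
    _ ≤ ((2 : ℝ) ^ d) ^ (k + 1) := hF
    _ = ((2 : ℝ) ^ (k + 1)) ^ d := by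
        rw [← Real.rpow_natCast, ← Real.rpow_natCast, ← Real.rpow_mul two_pos.le,
          ← Real.rpow_mul two_pos.le, mul_comm]
    _ ≤ (4 * q) ^ d := by
        refine Real.rpow_le_rpow (by positivity) ?_ hd
        rw [pow_succ]; linarith

theorem HalfRadiusCover.nonneg {X : Type u} [MetricSpace X] [Nonempty X] {d : ℝ}
    (h : HalfRadiusCover X d) : 0 ≤ d := by
  obtain ⟨S, hS, hcov⟩ := h (Classical.arbitrary X) 0 le_rfl
  have hne : S.Nonempty := by
    rw [Finset.nonempty_iff_ne_empty]
    rintro rfl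
    simpa using hcov (Metric.mem_closedBall_self le_rfl)
  by_contra! hd
  have h1 : (1 : ℝ) ≤ S.card := by exact_mod_cast hne.card_pos
  have := Real.rpow_lt_one_of_one_lt_of_neg (one_lt_two : (1 : ℝ) < 2) hd
  linarith

/-! ### Leaves and radii of ball trees -/

namespace BallTree

/-- The centers of the leaves. -/
def leaves {X : Type u} : BallTree X → Multiset X
  | leaf c => {c}
  | node _ l r => leaves l + leaves r

theorem card_leaves_pos {X : Type u} (t : BallTree X) : 0 < t.leaves.card := by
  induction t with
  | leaf c => simp [leaves]
  | node c l r hl hr => simp [leaves, hl]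

theorem dist_le_maxDist {X : Type u} [MetricSpace X] (a : X) {t : BallTree X} {x : X}
    (hx : x ∈ t.leaves) : dist a x ≤ t.maxDist a := by
  induction t with
  | leaf c => simp [leaves] at hx; simp [maxDist, hx]
  | node c l r hl hr =>
    rcases Multiset.mem_add.1 hx with h | h
    · exact (hl h).trans (le_max_left _ _)
    · exact (hr h).trans (le_max_right _ _)

theorem exists_maxDist_eq {X : Type u} [MetricSpace X] (a : X) (t : BallTree X) :
    ∃ x ∈ t.leaves, t.maxDist a = dist a x := by
  induction t with
  | leaf c => exact ⟨c, by simp [leaves], rfl⟩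
  | node c l r hl hr =>
    obtain ⟨x, hx, hx'⟩ := hl
    obtain ⟨y, hy, hy'⟩ := hr
    rcases max_choice (maxDist a l) (maxDist a r) with h | h
    · exact ⟨x, Multiset.mem_add.2 (.inl hx), by rw [maxDist, h, hx']⟩
    · exact ⟨y, Multiset.mem_add.2 (.inr hy), by rw [maxDist, h, hy']⟩

theorem dist_center_le_radius {X : Type u} [MetricSpace X] {t : BallTree X} {x : X}
    (hx : x ∈ t.leaves) : dist t.center x ≤ t.radius :=
  dist_le_maxDist _ hx

theorem radius_nonneg {X : Type u} [MetricSpace X] (t : BallTree X) : 0 ≤ t.radius := by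
  obtain ⟨x, -, h⟩ := t.exists_maxDist_eq t.center
  rw [radius, h]
  exact dist_nonneg

theorem dist_le_two_mul_radius {X : Type u} [MetricSpace X] {t : BallTree X} {x y : X}
    (hx : x ∈ t.leaves) (hy : y ∈ t.leaves) : dist x y ≤ 2 * t.radius := by
  have := dist_triangle_left x y t.center
  linarith [dist_center_le_radius hx, dist_center_le_radius hy]

theorem node_ne_left {X : Type u} (c : X) (l r : BallTree X) : node c l r ≠ l := fun h => by
  have := congrArg sizeOf h
  simp at this
  omega

theorem node_ne_right {X : Type u} (c : X) (l r : BallTree X) : node c l r ≠ r := fun h => by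
  have := congrArg sizeOf h
  simp at this

/-! ### The structure of greedy trees -/

theorem center_attach {X : Type u} (q p : X) (t : BallTree X) :
    (attach q p t).center = t.center := by
  cases t with
  | leaf c => by_cases h : c = q <;> simp [attach, h, center]
  | node c l r => rfl

open Classical in
-- `attach` acts on every leaf centered at `q`, hence the multiplicity. In a greedy tree it is one,
-- by injectivity of the permutation.
theorem leaves_attach {X : Type u} (q p : X) (t : BallTree X) :
    (attach q p t).leaves = t.leaves + Multiset.replicate (t.leaves.count q) p := by
  induction t with
  | leaf c =>
    by_cases h : c = q
    · simp [attach, h, leaves]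
    · simp [attach, h, leaves, Ne.symm h]
  | node c l r hl hr =>
    simp only [attach, leaves, hl, hr, Multiset.count_add, Multiset.replicate_add]
    ac_rfl

theorem mem_leaves_attach {X : Type u} {q p x : X} {t : BallTree X} :
    x ∈ (attach q p t).leaves ↔ x ∈ t.leaves ∨ (q ∈ t.leaves ∧ x = p) := by
  classical
  rw [leaves_attach, Multiset.mem_add, Multiset.mem_replicate, Multiset.count_ne_zero]

theorem leaves_build {X : Type u} {p : ℕ → X} {T : ℕ → ℕ} {m : ℕ}
    (hp : Set.InjOn p (Set.Iio m)) (hT : ∀ i, 0 < i → i < m → T i < i) {k : ℕ} (hk : k < m) :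
    (build p T k).leaves = (Multiset.range (k + 1)).map p := by
  classical
  induction k with
  | zero => simp [build, leaves]
  | succ k ih =>
    rw [build, leaves_attach, ih (by omega), Multiset.count_eq_one_of_mem,
      Multiset.range_succ (k + 1), Multiset.map_cons, Multiset.replicate_one, add_comm,
      Multiset.singleton_add]
    · refine Multiset.Nodup.map_on ?_ (Multiset.nodup_range _)
      intro x hx y hy h
      rw [Multiset.mem_range] at hx hy
      exact hp (show x < m by omega) (show y < m by omega) h
    · exact Multiset.mem_map_of_mem _ (Multiset.mem_range.2 (hT _ (by omega) hk))

/-- In every internal node, the leaves are tracked back to the center through the predecessor map,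
with the remaining geometric series of insertion distances as a potential. -/
def Tracked {X : Type u} [MetricSpace X] (α : ℝ) (p : ℕ → X) (T : ℕ → ℕ) (k : ℕ) :
    BallTree X → Prop
  | leaf _ => True
  | node c l r => l.center = c ∧
      (∃ i, 0 < i ∧ i ≤ k ∧ r.center = p i ∧ ∀ x ∈ (node c l r).leaves, x = c ∨
        ∃ j, 0 < j ∧ j ≤ k ∧ x = p j ∧ dist c x + dist (p j) (p (T j)) / (α - 1) ≤
          α ^ 3 / (α - 1) * prefixDist p i (p i)) ∧
      Tracked α p T k l ∧ Tracked α p T k r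

/-- One factor `α` comes from the approximate predecessor, the other from the greedy choice at stage
`i`; in between, the distance to the prefix only drops as the prefix grows. -/
theorem dist_predecessor_le {X : Type u} [MetricSpace X] {α : ℝ} (hα : 1 < α) {A : Finset X}
    {p : ℕ → X} {T : ℕ → ℕ} (hp : IsGreedyPermutation α A p) (hT : IsPredecessorMap α A.card p T)
    {i k : ℕ} (hi : 0 < i) (hik : i ≤ k) (hk : k < A.card) :
    dist (p k) (p (T k)) ≤ α ^ 2 * prefixDist p i (p i) := by
  have h1 := hT.approx k (by omega) hk
  have hmem : p k ∈ A := by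
    have : p k ∈ (A : Set X) := hp.image_eq ▸ Set.mem_image_of_mem p (show k < A.card from hk)
    exact this
  have h2 := hp.greedy i hi (by omega) (p k) hmem
  have h3 : prefixDist p k (p k) ≤ prefixDist p i (p k) :=
    Metric.infDist_le_infDist_of_subset (Set.image_mono (Set.Iio_subset_Iio hik))
      ⟨p 0, Set.mem_image_of_mem p hi⟩
  have h4 : prefixDist p i (p k) ≤ α * prefixDist p i (p i) := by
    rwa [one_div, inv_mul_le_iff₀ (by linarith)] at h2
  nlinarith

/-- The potential `dist (p j) (p (T j)) / (α - 1)` is the sum of all further steps that scaling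
permits after `p j`. A new leaf attached to `p j` pays for its own step and its own potential out of
this sum. One attached to `c` itself starts a new chain, and `key` bounds it directly. -/
theorem Tracked.attach {X : Type u} [MetricSpace X] {α : ℝ} (hα : 1 < α) {A : Finset X}
    {p : ℕ → X} {T : ℕ → ℕ} (hp : IsGreedyPermutation α A p) (hT : IsPredecessorMap α A.card p T)
    {k : ℕ} (hk : k + 1 < A.card) {t : BallTree X} (ht : Tracked α p T k t) :
    Tracked α p T (k + 1) (attach (p (T (k + 1))) (p (k + 1)) t) := by
  have hα' : 0 < α - 1 := by linarith
  -- A step `e` with its potential costs `e + e / (α - 1) = α / (α - 1) * e`, and `e ≤ α ^ 2 *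
  -- prefixDist p i (p i)`; this is where `α ^ 3 / (α - 1)` comes from.
  have key : ∀ i, 0 < i → i ≤ k + 1 → dist (p (T (k + 1))) (p (k + 1)) +
      dist (p (k + 1)) (p (T (k + 1))) / (α - 1) ≤ α ^ 3 / (α - 1) * prefixDist p i (p i) := by
    intro i hi hik
    have h := dist_predecessor_le hα hp hT hi hik hk
    have e : dist (p (T (k + 1))) (p (k + 1)) + dist (p (k + 1)) (p (T (k + 1))) / (α - 1) =
        α / (α - 1) * dist (p (k + 1)) (p (T (k + 1))) := by
      rw [dist_comm (p (T (k + 1)))]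
      field_simp
      ring
    calc _ = α / (α - 1) * dist (p (k + 1)) (p (T (k + 1))) := e
      _ ≤ α / (α - 1) * (α ^ 2 * prefixDist p i (p i)) := by gcongr
      _ = _ := by ring
  induction t with
  | leaf c =>
    by_cases h : c = p (T (k + 1))
    · simp only [BallTree.attach, h, if_true, Tracked, and_true]
      refine ⟨rfl, k + 1, by omega, le_rfl, rfl, fun x hx => ?_⟩
      simp only [leaves, Multiset.mem_add, Multiset.mem_singleton] at hx
      rcases hx with rfl | rfl
      · exact .inl rfl
      · exact .inr ⟨k + 1, by omega, le_rfl, rfl, key _ (by omega) le_rfl⟩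
    · simp [BallTree.attach, h, Tracked]
  | node c l r hl hr =>
    obtain ⟨hc, ⟨i, hi, hik, hri, hlv⟩, hl', hr'⟩ := ht
    refine ⟨by rw [center_attach, hc], ⟨i, hi, by omega, by rw [center_attach, hri], ?_⟩,
      hl hl', hr hr'⟩
    intro x hx
    rcases mem_leaves_attach (t := node c l r).1 hx with hx | ⟨hq, rfl⟩
    · exact (hlv x hx).imp_right fun ⟨j, hj, hjk, h⟩ => ⟨j, hj, by omega, h⟩
    · refine .inr ⟨k + 1, by omega, le_rfl, rfl, ?_⟩
      rcases hlv _ hq with h | ⟨j, hj, hjk, hpj, hle⟩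
      · rw [← h]
        exact key i hi (by omega)
      -- The tree records only points. Injectivity recovers the index of the predecessor, which is
      -- positive, so the scaling condition applies.
      · have hTj : T (k + 1) = j := hp.injOn
          (show T (k + 1) < A.card from (hT.lt _ (by omega) hk).trans hk)
          (show j < A.card by omega) hpj
        have h1 := hT.scaling (k + 1) (by omega) hk (by omega)
        rw [hTj, one_div, ← div_eq_inv_mul, le_div_iff₀ (by linarith)] at h1
        rw [hTj] at hle ⊢
        have h2 := dist_triangle c (p j) (p (k + 1))
        have h3 : dist (p (k + 1)) (p j) + dist (p (k + 1)) (p j) / (α - 1) ≤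
            dist (p j) (p (T j)) / (α - 1) := by
          rw [← sub_nonneg]
          have : dist (p j) (p (T j)) / (α - 1) -
            (dist (p (k + 1)) (p j) + dist (p (k + 1)) (p j) / (α - 1)) =
            (dist (p j) (p (T j)) - dist (p (k + 1)) (p j) * α) / (α - 1) := by
            field_simp
            ring
          rw [this]
          exact div_nonneg (by linarith) hα'.le
        rw [dist_comm (p (k + 1))] at h3 ⊢
        linarith

theorem tracked_build {X : Type u} [MetricSpace X] {α : ℝ} (hα : 1 < α) {A : Finset X}
    {p : ℕ → X} {T : ℕ → ℕ} (hp : IsGreedyPermutation α A p) (hT : IsPredecessorMap α A.card p T)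
    {k : ℕ} (hk : k < A.card) : Tracked α p T k (build p T k) := by
  induction k with
  | zero => trivial
  | succ k ih => exact (ih (by omega)).attach hα hp hT hk

/-- Every right child is centered at a point `p i` whose distance to the prefix before it is at
least the radius of the parent, up to the factor `κ`. -/
def Spread {X : Type u} [MetricSpace X] (p : ℕ → X) (κ : ℝ) : BallTree X → Prop
  | leaf _ => True
  | node c l r => l.center = c ∧
      (∃ i, r.center = p i ∧ (node c l r).radius ≤ κ * prefixDist p i (p i)) ∧
      Spread p κ l ∧ Spread p κ r

theorem Tracked.spread {X : Type u} [MetricSpace X] {α : ℝ} (hα : 1 < α) {p : ℕ → X} {T : ℕ → ℕ}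
    {k : ℕ} {t : BallTree X} (ht : Tracked α p T k t) : Spread p (α ^ 3 / (α - 1)) t := by
  have hα' : 0 < α - 1 := by linarith
  induction t with
  | leaf c => trivial
  | node c l r hl hr =>
    obtain ⟨hc, ⟨i, hi, hik, hri, hlv⟩, hl', hr'⟩ := ht
    refine ⟨hc, ⟨i, hri, ?_⟩, hl hl', hr hr'⟩
    obtain ⟨x, hx, hx'⟩ := (node c l r).exists_maxDist_eq c
    have h0 : 0 ≤ prefixDist p i (p i) := Metric.infDist_nonneg
    rw [radius, center, hx']
    rcases hlv x hx with rfl | ⟨j, hj, hjk, rfl, hle⟩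
    · rw [dist_self]
      have : 0 < α := by linarith
      positivity
    · have : 0 ≤ dist (p j) (p (T j)) / (α - 1) := by positivity
      linarith

theorem Spread.center_mem {X : Type u} [MetricSpace X] {p : ℕ → X} {κ : ℝ} {t : BallTree X}
    (ht : Spread p κ t) : t.center ∈ t.leaves := by
  induction t with
  | leaf c => simp [leaves, center]
  | node c l r hl hr => exact Multiset.mem_add.2 (.inl (ht.1 ▸ hl ht.2.2.1))

theorem center_build {X : Type u} (p : ℕ → X) (T : ℕ → ℕ) (k : ℕ) :
    (build p T k).center = p 0 := by
  induction k with
  | zero => rfl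
  | succ k ih => rw [build, center_attach, ih]

end BallTree

theorem IsGreedyTree.leaves_eq {X : Type u} [MetricSpace X] {α : ℝ} {A : Finset X}
    {G : BallTree X} (h : IsGreedyTree α A G) : G.leaves = A.val := by
  obtain ⟨hA, p, T, hp, hT, rfl⟩ := h
  have hpos := hA.card_pos
  rw [BallTree.leaves_build hp.injOn hT.lt (by omega), Nat.sub_add_cancel hpos]
  refine (Multiset.Nodup.ext (Multiset.Nodup.map_on ?_ (Multiset.nodup_range _)) A.nodup).2 ?_
  · intro x hx y hy h
    exact hp.injOn (Multiset.mem_range.1 hx) (Multiset.mem_range.1 hy) h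
  · intro a
    have := Set.ext_iff.1 hp.image_eq a
    simpa using this

theorem IsGreedyTree.exists_spread {X : Type u} [MetricSpace X] {α : ℝ} (hα : 1 < α)
    {A : Finset X} {G : BallTree X} (h : IsGreedyTree α A G) :
    ∃ p : ℕ → X, G.center = p 0 ∧ G.Spread p (α ^ 3 / (α - 1)) := by
  obtain ⟨hA, p, T, hp, hT, rfl⟩ := h
  have hpos := hA.card_pos
  exact ⟨p, BallTree.center_build _ _ _, (BallTree.tracked_build hα hp hT (by omega)).spread hα⟩

/-! ### Effect and cost of the parts of the program -/

namespace Hausdorff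

theorem centerDist_run {X : Type u} [MetricSpace X] (x y : Vertex X) (M : Memory X) :
    centerDist x y M = (dist x.tree.center y.tree.center, M, 3) := rfl

theorem gap_run {X : Type u} [MetricSpace X] (x y : Vertex X) (M : Memory X) :
    gap x y M = (dist x.tree.center y.tree.center - y.tree.radius, M, 5) := rfl

/-- A loop rule: `P vs M` holds when the elements of `vs` are still to be processed. -/
theorem forEach_rule {X : Type u} {f : Vertex X → Comp X Unit} {k : ℕ}
    (P : List (Vertex X) → Memory X → Prop)
    (h : ∀ v vs M, P (v :: vs) M → P vs (f v M).2.1 ∧ (f v M).2.2 ≤ k)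
    (l : List (Vertex X)) (M : Memory X) (h0 : P l M) :
    P [] (forEach f l M).2.1 ∧ (forEach f l M).2.2 ≤ (k + 1) * l.length + 1 := by
  induction l generalizing M with
  | nil => exact ⟨h0, by simp [forEach, tick, Comp.query, Comp.instr]⟩
  | cons v vs ih =>
    obtain ⟨h1, h2⟩ := h v vs M h0
    obtain ⟨h3, h4⟩ := ih _ h1
    refine ⟨h3, ?_⟩
    have e : (forEach f (v :: vs) M).2.2 =
        1 + ((f v M).2.2 + (forEach f vs (f v M).2.1).2.2) := rfl
    rw [e, List.length_cons]
    linarith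

theorem minOver_run {X : Type u} {f : Vertex X → Comp X ℝ} {g : Vertex X → ℝ} {k : ℕ}
    {M : Memory X} (hf : ∀ v, f v M = (g v, M, k)) {l : List (Vertex X)} (hl : l ≠ []) :
    ∃ m c, minOver f l M = (m, M, c) ∧ (∃ v ∈ l, m = g v) ∧ (∀ v ∈ l, m ≤ g v) ∧
      c ≤ (k + 2) * l.length := by
  induction l with
  | nil => exact absurd rfl hl
  | cons v vs ih =>
    cases vs with
    | nil =>
      refine ⟨g v, 1 + k, ?_, ⟨v, by simp, rfl⟩, by simp, by simp; omega⟩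
      simp [minOver, Comp.bind, tick, Comp.query, Comp.instr, hf]
    | cons v' vs =>
      obtain ⟨m, c, h1, ⟨w, hw, hmw⟩, h3, h4⟩ := ih (by simp)
      refine ⟨min (g v) m, 1 + (k + (c + 1)), ?_, ?_, ?_, ?_⟩
      · simp [minOver, Comp.bind, tick, Comp.query, Comp.instr, hf, h1, minimum]
      · rcases min_choice (g v) m with h | h
        · exact ⟨v, by simp, h⟩
        · exact ⟨w, List.mem_cons_of_mem _ hw, by rw [h, hmw]⟩
      · intro y hy
        rcases List.mem_cons.1 hy with rfl | hy
        · exact min_le_left _ _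
        · exact (min_le_right _ _).trans (h3 y hy)
      · rw [List.length_cons]
        linarith

open Classical in
theorem deleteFrom_run {X : Type u} (x : Vertex X) (l : List (Vertex X)) (M : Memory X) :
    ∃ c, deleteFrom x l M = (l.filter (· ≠ x), M, c) ∧ c ≤ 3 * l.length + 1 := by
  induction l with
  | nil => exact ⟨1, rfl, by simp⟩
  | cons v vs ih =>
    obtain ⟨c, h1, h2⟩ := ih
    by_cases h : v = x
    · refine ⟨1 + (1 + c), ?_, by simp; omega⟩
      simp [deleteFrom, Comp.bind, tick, same, Comp.query, Comp.instr, h, h1]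
    · refine ⟨1 + (1 + (c + 1)), ?_, by simp; omega⟩
      simp [deleteFrom, Comp.bind, tick, same, prepend, Comp.query, Comp.instr, h, h1]

theorem updateLow_run {X : Type u} [MetricSpace X] (x : Vertex X) (M : Memory X)
    (hx : M.adj x ≠ []) : ∃ y ∈ M.adj x,
      (∀ y' ∈ M.adj x, dist x.tree.center y.tree.center - y.tree.radius ≤
        dist x.tree.center y'.tree.center - y'.tree.radius) ∧
      (updateLow x M).2.1.adj = M.adj ∧
      (updateLow x M).2.1.best =
        max M.best (max (dist x.tree.center y.tree.center - y.tree.radius) 0) ∧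
      (updateLow x M).2.2 ≤ 7 * (M.adj x).length + 6 := by
  obtain ⟨m, c, h1, ⟨y, hy, rfl⟩, h3, h4⟩ := minOver_run (M := M) (fun v => gap_run x v M) hx
  refine ⟨y, hy, h3, ?_, ?_, ?_⟩ <;>
    simp only [updateLow, Comp.bind, getAdj, Comp.query, Comp.instr, maximum, setLow, getBest,
      setBest, h1]
  omega

open Classical in
theorem pruneAbove_run {X : Type u} [MetricSpace X] (x : Vertex X) (t : ℝ) (D : ℕ)
    (l : List (Vertex X)) (M : Memory X) (hD : ∀ v, (M.adj v).length ≤ D) :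
    (pruneAbove x t l M).1 =
      l.filter (fun y => dist x.tree.center y.tree.center - y.tree.radius ≤ t) ∧
    (pruneAbove x t l M).2.1.best = M.best ∧
    (∀ v, (pruneAbove x t l M).2.1.adj v =
      if v ∈ l ∧ t < dist x.tree.center v.tree.center - v.tree.radius
      then (M.adj v).filter (· ≠ x) else M.adj v) ∧
    (pruneAbove x t l M).2.2 ≤ (3 * D + 10) * l.length + 1 := by
  induction l generalizing M with
  | nil => simp [pruneAbove, Comp.bind, tick, Comp.query, Comp.instr, Comp.ret]
  | cons y ys ih =>
    by_cases h : t < dist x.tree.center y.tree.center - y.tree.radius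
    · obtain ⟨c, h1, h2⟩ := deleteFrom_run x (M.adj y) M
      set M' : Memory X :=
        { M with adj := Function.update M.adj y ((M.adj y).filter (· ≠ x)) } with hM'
      have hadj : ∀ v, M'.adj v = if v = y then (M.adj y).filter (· ≠ x) else M.adj v :=
        fun v => by simp [hM', Function.update_apply]
      have hD' : ∀ v, (M'.adj v).length ≤ D := fun v => by
        rw [hadj]
        split_ifs
        · exact (List.length_filter_le _ _).trans (hD y)
        · exact hD v
      have e : pruneAbove x t (y :: ys) M = ((pruneAbove x t ys M').1,
          (pruneAbove x t ys M').2.1, 1 + (5 + (1 + (1 + (c + (1 +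
            (pruneAbove x t ys M').2.2)))))) := by
        simp [pruneAbove, Comp.bind, tick, Comp.query, Comp.instr, gap_run, lessThan, h, getAdj,
          h1, setAdj, hM']
      obtain ⟨i1, i2, i3, i4⟩ := ih M' hD'
      rw [e]
      refine ⟨?_, i2, fun v => ?_, ?_⟩
      · rw [List.filter_cons_of_neg (by simpa only [decide_eq_true_eq, not_le] using h)]
        exact i1
      · rw [i3, hadj]
        by_cases hv : v = y
        · subst hv
          simp [h]
        · simp [hv]
      · have := hD y
        simp only [List.length_cons]
        linarith
    · have e : pruneAbove x t (y :: ys) M = (y :: (pruneAbove x t ys M).1,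
          (pruneAbove x t ys M).2.1, 1 + (5 + (1 + ((pruneAbove x t ys M).2.2 + 1)))) := by
        simp [pruneAbove, Comp.bind, tick, Comp.query, Comp.instr, gap_run, lessThan, h, prepend]
      obtain ⟨i1, i2, i3, i4⟩ := ih M hD
      rw [e]
      refine ⟨?_, i2, fun v => ?_, ?_⟩
      · rw [List.filter_cons_of_pos (by simpa only [decide_eq_true_eq, not_lt] using h), ← i1]
      · rw [i3]
        by_cases hv : v = y
        · subst hv
          simp [h]
        · simp [hv]
      · simp only [List.length_cons]
        linarith

open Classical in
theorem prune_run {X : Type u} [MetricSpace X] (x : Vertex X) (D : ℕ) (M : Memory X)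
    (hD : ∀ v, (M.adj v).length ≤ D) (hx : M.adj x ≠ []) : ∃ y' ∈ M.adj x,
    (∀ y ∈ M.adj x, dist x.tree.center y'.tree.center ≤ dist x.tree.center y.tree.center) ∧
    (prune x M).2.1.best = M.best ∧
    (∀ v, (prune x M).2.1.adj v =
      if v = x then (M.adj x).filter (fun y => dist x.tree.center y.tree.center - y.tree.radius ≤
        dist x.tree.center y'.tree.center + 2 * x.tree.radius)
      else if v ∈ M.adj x ∧ dist x.tree.center y'.tree.center + 2 * x.tree.radius <
        dist x.tree.center v.tree.center - v.tree.radius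
      then (M.adj v).filter (· ≠ x) else M.adj v) ∧
    (prune x M).2.2 ≤ (3 * D + 15) * D + 6 := by
  obtain ⟨m, c, h1, ⟨y, hy, rfl⟩, h3, h4⟩ :=
    minOver_run (M := M) (fun v => centerDist_run x v M) hx
  obtain ⟨i1, i2, i3, i4⟩ := pruneAbove_run x
    (dist x.tree.center y.tree.center + 2 * x.tree.radius) D (M.adj x) M hD
  have e : prune x M = ((), { (pruneAbove x
      (dist x.tree.center y.tree.center + 2 * x.tree.radius) (M.adj x) M).2.1 with
      adj := Function.update (pruneAbove x (dist x.tree.center y.tree.center + 2 * x.tree.radius)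
        (M.adj x) M).2.1.adj x (pruneAbove x
          (dist x.tree.center y.tree.center + 2 * x.tree.radius) (M.adj x) M).1 },
      1 + (c + (1 + (1 + (1 + ((pruneAbove x
        (dist x.tree.center y.tree.center + 2 * x.tree.radius) (M.adj x) M).2.2 + 1)))))) := by
    simp [prune, Comp.bind, Comp.query, Comp.instr, h1, getAdj, getRadius, add, setAdj, two_mul]
  rw [e]
  refine ⟨y, hy, h3, i2, fun v => ?_, ?_⟩
  · simp only [Function.update_apply, i1, i3]
  · have := hD x
    show 1 + (c + _) ≤ _
    nlinarith

open Classical in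
theorem splitVertex_run {X : Type u} (z zl zr : Vertex X) (D : ℕ) (M : Memory X)
    (hD : ∀ v, (M.adj v).length ≤ D) (hnd : (M.adj z).Nodup) (hl : zl ∉ M.adj z)
    (hr : zr ∉ M.adj z) :
    (splitVertex z zl zr M).1 = M.adj z ∧ (splitVertex z zl zr M).2.1.best = M.best ∧
    (∀ v, (splitVertex z zl zr M).2.1.adj v = if v = z then [] else
      if v ∈ M.adj z then zl :: zr :: (M.adj v).filter (· ≠ z) else
      if v = zl ∨ v = zr then M.adj z else M.adj v) ∧
    (splitVertex z zl zr M).2.2 ≤ (3 * D + 6) * D + 5 := by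
  set M₁ : Memory X :=
    { M with adj := Function.update (Function.update M.adj zl (M.adj z)) zr (M.adj z) } with hM₁
  have hadj : ∀ v, M₁.adj v = if v = zl ∨ v = zr then M.adj z else M.adj v := fun v => by
    simp only [hM₁, Function.update_apply]
    split_ifs <;> first | rfl | tauto
  have hD₁ : ∀ v, (M₁.adj v).length ≤ D := fun v => by
    rw [hadj]
    split_ifs <;> apply hD
  -- Loop invariant: the neighbours no longer in `vs` have been rewritten and everything else is as
  -- in `M₁`. Absence of duplicates ensures that none is rewritten twice.
  obtain ⟨⟨-, -, h3, h4⟩, h5⟩ := forEach_rule (f := replaceIn z zl zr) (k := 3 * D + 5)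
    (fun vs N => vs.Nodup ∧ (∀ v ∈ vs, v ∈ M.adj z) ∧ N.best = M.best ∧
      ∀ v, N.adj v = if v ∈ M.adj z ∧ v ∉ vs then zl :: zr :: (M.adj v).filter (· ≠ z)
        else M₁.adj v)
    (by
      rintro v vs N ⟨n1, n2, n3, n4⟩
      have hv : N.adj v = M₁.adj v := by rw [n4, if_neg (by simp)]
      have hvM : M₁.adj v = M.adj v := by
        rw [hadj, if_neg]
        rintro (rfl | rfl)
        · exact hl (n2 _ (by simp))
        · exact hr (n2 _ (by simp))
      obtain ⟨c, h1, h2⟩ := deleteFrom_run z (M.adj v) N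
      have e : replaceIn z zl zr v N = ((),
          { N with adj := Function.update N.adj v (zl :: zr :: (M.adj v).filter (· ≠ z)) },
          1 + (c + (1 + (1 + 1)))) := by
        simp [replaceIn, Comp.bind, Comp.query, Comp.instr, getAdj, hv, hvM, h1, prepend, setAdj]
      rw [e]
      refine ⟨⟨(List.nodup_cons.1 n1).2, fun w hw => n2 w (by simp [hw]), n3, fun w => ?_⟩, ?_⟩
      · simp only [Function.update_apply, n4]
        by_cases hw : w = v
        · subst hw
          simp [n2 w (by simp), (List.nodup_cons.1 n1).1]
        · simp [hw]
      · have := hD v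
        show 1 + (c + _) ≤ _
        omega)
    (M.adj z) M₁ ⟨hnd, fun _ h => h, rfl, fun v => by simp⟩
  have e : splitVertex z zl zr M = (M.adj z,
      { (forEach (replaceIn z zl zr) (M.adj z) M₁).2.1 with
        adj := Function.update (forEach (replaceIn z zl zr) (M.adj z) M₁).2.1.adj z [] },
      1 + (1 + (1 + ((forEach (replaceIn z zl zr) (M.adj z) M₁).2.2 + 1)))) := by
    simp [splitVertex, Comp.bind, Comp.instr, getAdj, setAdj, Comp.ret, hM₁]
  rw [e]
  refine ⟨rfl, h3, fun v => ?_, ?_⟩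
  · simp only [Function.update_apply, h4]
    simp [hadj]
  · have := hD z
    show 1 + (1 + (1 + (_ + 1))) ≤ _
    nlinarith

end Hausdorff

/-! ### Points below the nodes of a heap -/

/-- The points below a node, labelled with the side of the node. -/
def Vertex.points {X : Type u} (v : Vertex X) : Multiset (Side × X) :=
  v.tree.leaves.map (Prod.mk v.side)

theorem Vertex.mem_points {X : Type u} {v : Vertex X} {s : Side} {x : X} :
    (s, x) ∈ v.points ↔ v.side = s ∧ x ∈ v.tree.leaves := by
  simp [Vertex.points, and_comm]

theorem Vertex.card_points_pos {X : Type u} (v : Vertex X) : 0 < v.points.card := by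
  rw [Vertex.points, Multiset.card_map]
  exact v.tree.card_leaves_pos

/-- The disjoint union of two point sets. -/
def labelled {X : Type u} (A B : Finset X) : Multiset (Side × X) :=
  A.val.map (Prod.mk Side.inA) + B.val.map (Prod.mk Side.inB)

theorem nodup_labelled {X : Type u} (A B : Finset X) : (labelled A B).Nodup := by
  refine Multiset.nodup_add.2 ⟨A.nodup.map (Prod.mk_right_injective _),
    B.nodup.map (Prod.mk_right_injective _), ?_⟩
  rw [Multiset.disjoint_left]
  simp

theorem mem_labelled_inA {X : Type u} {A B : Finset X} {x : X} :
    (Side.inA, x) ∈ labelled A B ↔ x ∈ A := by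
  simp [labelled]

theorem mem_labelled_inB {X : Type u} {A B : Finset X} {x : X} :
    (Side.inB, x) ∈ labelled A B ↔ x ∈ B := by
  simp [labelled]

theorem Multiset.nodup_of_nodup_bind {β : Type v} {γ : Type w} {s : Multiset β}
    {f : β → Multiset γ} (hf : ∀ b ∈ s, ∃ c, c ∈ f b) (h : (s.bind f).Nodup) : s.Nodup := by
  induction s using Multiset.induction_on with
  | empty => exact Multiset.nodup_zero
  | cons a s ih =>
    rw [Multiset.cons_bind, Multiset.nodup_add] at h
    refine Multiset.nodup_cons.2 ⟨fun ha => ?_,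
      ih (fun b hb => hf b (Multiset.mem_cons_of_mem hb)) h.2.1⟩
    obtain ⟨c, hc⟩ := hf a (Multiset.mem_cons_self a s)
    exact Multiset.disjoint_left.1 h.2.2 hc (Multiset.mem_bind.2 ⟨a, ha, hc⟩)

theorem Multiset.eq_of_nodup_bind {β : Type v} {γ : Type w} {s : Multiset β}
    {f : β → Multiset γ} (h : (s.bind f).Nodup) {a b : β} {c : γ} (ha : a ∈ s) (hb : b ∈ s)
    (hca : c ∈ f a) (hcb : c ∈ f b) : a = b := by
  by_contra hne
  obtain ⟨t, rfl⟩ := Multiset.exists_cons_of_mem ha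
  rw [Multiset.cons_bind, Multiset.nodup_add] at h
  have hb' : b ∈ t := (Multiset.mem_cons.1 hb).resolve_left (Ne.symm hne)
  exact Multiset.disjoint_left.1 h.2.2 hca (Multiset.mem_bind.2 ⟨b, hb', hcb⟩)

/-- Each pop enlarges the heap by one node and preserves the points below it, and every node has at
least one point below it. -/
theorem RadiusOrder.length_add_card_le {X : Type u} [MetricSpace X] {H : Multiset (Vertex X)}
    {zs : List (Vertex X)} (h : RadiusOrder H zs) :
    zs.length + H.card ≤ (H.bind Vertex.points).card := by
  induction h with
  | done H h =>
    clear h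
    induction H using Multiset.induction_on with
    | empty => simp
    | cons v H ih =>
      have := v.card_points_pos
      simp only [Multiset.cons_bind, Multiset.card_add, Multiset.card_cons, List.length_nil] at ih ⊢
      omega
  | pop H s c l r zs hpos hmax h ih =>
    simp only [Multiset.cons_bind, Multiset.card_add, Multiset.card_cons, List.length_cons,
      Vertex.points, Multiset.card_map, BallTree.leaves] at ih ⊢
    omega

/-- The nodes of the heap `H` partition `A` and `B`; on each side their centers have pairwise
distances at least `ρ`, witnessed by the greedy permutation `p`; and their diameters are at most
`2 * κ * ρ`. -/
structure HeapInv {X : Type u} [MetricSpace X] (A B : Finset X) (p : Side → ℕ → X) (κ ρ : ℝ)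
    (H : Multiset (Vertex X)) : Prop where
  points : H.bind Vertex.points = labelled A B
  spread : ∀ v ∈ H, v.tree.Spread (p v.side) κ
  placed : ∀ v ∈ H, ∃ k, v.tree.center = p v.side k ∧
    (k = 0 ∨ ρ ≤ prefixDist (p v.side) k (p v.side k))
  diam : ∀ v ∈ H, ∀ x ∈ v.tree.leaves, ∀ y ∈ v.tree.leaves, dist x y ≤ 2 * κ * ρ

namespace HeapInv

theorem nodup {X : Type u} [MetricSpace X] {A B : Finset X} {p : Side → ℕ → X} {κ ρ : ℝ}
    {H : Multiset (Vertex X)} (h : HeapInv A B p κ ρ H) : H.Nodup :=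
  Multiset.nodup_of_nodup_bind (fun v _ => Multiset.card_pos_iff_exists_mem.1 v.card_points_pos)
    (h.points ▸ nodup_labelled A B)

theorem eq_of_mem_leaves {X : Type u} [MetricSpace X] {A B : Finset X} {p : Side → ℕ → X}
    {κ ρ : ℝ} {H : Multiset (Vertex X)} (h : HeapInv A B p κ ρ H) {v w : Vertex X} (hv : v ∈ H)
    (hw : w ∈ H) (hs : v.side = w.side) {x : X} (hxv : x ∈ v.tree.leaves)
    (hxw : x ∈ w.tree.leaves) : v = w :=
  Multiset.eq_of_nodup_bind (h.points ▸ nodup_labelled A B) hv hw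
    (Vertex.mem_points.2 ⟨rfl, hxv⟩) (Vertex.mem_points.2 ⟨hs.symm, hxw⟩)

theorem mem_labelled {X : Type u} [MetricSpace X] {A B : Finset X} {p : Side → ℕ → X}
    {κ ρ : ℝ} {H : Multiset (Vertex X)} (h : HeapInv A B p κ ρ H) {s : Side} {x : X} :
    (s, x) ∈ labelled A B ↔ ∃ v ∈ H, v.side = s ∧ x ∈ v.tree.leaves := by
  simp only [← h.points, Multiset.mem_bind, Vertex.mem_points]

theorem center_mem {X : Type u} [MetricSpace X] {A B : Finset X} {p : Side → ℕ → X}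
    {κ ρ : ℝ} {H : Multiset (Vertex X)} (h : HeapInv A B p κ ρ H) {v : Vertex X} (hv : v ∈ H) :
    v.tree.center ∈ v.tree.leaves :=
  (h.spread v hv).center_mem

theorem center_mem_A {X : Type u} [MetricSpace X] {A B : Finset X} {p : Side → ℕ → X}
    {κ ρ : ℝ} {H : Multiset (Vertex X)} (h : HeapInv A B p κ ρ H) {v : Vertex X} (hv : v ∈ H)
    (hs : v.side = .inA) : v.tree.center ∈ A :=
  mem_labelled_inA.1 (h.mem_labelled.2 ⟨v, hv, hs, h.center_mem hv⟩)

theorem center_mem_B {X : Type u} [MetricSpace X] {A B : Finset X} {p : Side → ℕ → X}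
    {κ ρ : ℝ} {H : Multiset (Vertex X)} (h : HeapInv A B p κ ρ H) {v : Vertex X} (hv : v ∈ H)
    (hs : v.side = .inB) : v.tree.center ∈ B :=
  mem_labelled_inB.1 (h.mem_labelled.2 ⟨v, hv, hs, h.center_mem hv⟩)

/-- Of two centers, the one inserted later is at least `ρ` away from its whole prefix, which
contains the other. Equal indices would give a common leaf. -/
theorem separated {X : Type u} [MetricSpace X] {A B : Finset X} {p : Side → ℕ → X}
    {κ ρ : ℝ} {H : Multiset (Vertex X)} (h : HeapInv A B p κ ρ H) {v w : Vertex X} (hv : v ∈ H)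
    (hw : w ∈ H) (hs : v.side = w.side) (hne : v ≠ w) :
    ρ ≤ dist v.tree.center w.tree.center := by
  obtain ⟨j, hj, hj'⟩ := h.placed v hv
  obtain ⟨k, hk, hk'⟩ := h.placed w hw
  rw [← hs] at hk hk'
  rw [hj, hk]
  rcases lt_trichotomy j k with hjk | rfl | hjk
  · rw [dist_comm]
    exact (hk'.resolve_left (by omega)).trans
      (Metric.infDist_le_dist_of_mem (Set.mem_image_of_mem _ hjk))
  · refine absurd (h.eq_of_mem_leaves hv hw hs (h.center_mem hv) ?_) hne
    rw [hj, ← hk]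
    exact h.center_mem hw
  · exact (hj'.resolve_left (by omega)).trans
      (Metric.infDist_le_dist_of_mem (Set.mem_image_of_mem _ hjk))

theorem radius_le {X : Type u} [MetricSpace X] {A B : Finset X} {p : Side → ℕ → X}
    {κ ρ : ℝ} {H : Multiset (Vertex X)} (h : HeapInv A B p κ ρ H) {v : Vertex X} (hv : v ∈ H) :
    v.tree.radius ≤ 2 * κ * ρ := by
  obtain ⟨x, hx, hx'⟩ := v.tree.exists_maxDist_eq v.tree.center
  rw [BallTree.radius, hx']
  exact h.diam v hv _ (h.center_mem hv) _ hx

/-- The left child keeps the center of its parent; the right child is centered at a point that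
`Spread` places at least radius over `κ` away from its prefix. -/
theorem pop {X : Type u} [MetricSpace X] {A B : Finset X} {p : Side → ℕ → X} {κ ρ : ℝ}
    (hκ : 0 < κ) {H : Multiset (Vertex X)} {s : Side} {c : X} {l r : BallTree X}
    (h : HeapInv A B p κ ρ (⟨s, .node c l r⟩ ::ₘ H))
    (hmax : ∀ v ∈ H, v.tree.radius ≤ (BallTree.node c l r).radius) :
    HeapInv A B p κ (min ρ ((BallTree.node c l r).radius / κ)) (⟨s, l⟩ ::ₘ ⟨s, r⟩ ::ₘ H) := by
  obtain ⟨hc, ⟨i, hi, hir⟩, hl, hr⟩ := h.spread _ (Multiset.mem_cons_self _ _)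
  obtain ⟨k, hk, hk'⟩ := h.placed _ (Multiset.mem_cons_self _ _)
  have hz := h.diam _ (Multiset.mem_cons_self _ _)
  -- The new bound is `min (2 * κ * ρ) (2 * r)` with `r` the popped radius. The children inherit
  -- both bounds from the point set of the parent, the other nodes satisfy the second because `r` is
  -- maximal.
  have hdiam : ∀ x y : X, dist x y ≤ 2 * κ * ρ → dist x y ≤ 2 * (BallTree.node c l r).radius →
      dist x y ≤ 2 * κ * min ρ ((BallTree.node c l r).radius / κ) := fun x y h1 h2 => by
    rw [mul_min_of_nonneg _ _ (by positivity)]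
    refine le_min h1 (h2.trans_eq ?_)
    field_simp
  refine ⟨?_, ?_, ?_, ?_⟩
  · rw [← h.points]
    simp only [Multiset.cons_bind, Vertex.points, BallTree.leaves, Multiset.map_add, add_assoc]
  · intro v hv
    rcases Multiset.mem_cons.1 hv with rfl | hv
    · exact hl
    rcases Multiset.mem_cons.1 hv with rfl | hv
    · exact hr
    · exact h.spread v (Multiset.mem_cons_of_mem hv)
  · intro v hv
    rcases Multiset.mem_cons.1 hv with rfl | hv
    · exact ⟨k, by rw [← hk]; exact hc, hk'.imp_right (min_le_left _ _).trans⟩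
    rcases Multiset.mem_cons.1 hv with rfl | hv
    · refine ⟨i, hi, .inr ((min_le_right _ _).trans ?_)⟩
      rwa [div_le_iff₀' hκ]
    · obtain ⟨j, hj, hj'⟩ := h.placed v (Multiset.mem_cons_of_mem hv)
      exact ⟨j, hj, hj'.imp_right (min_le_left _ _).trans⟩
  · intro v hv
    rcases Multiset.mem_cons.1 hv with rfl | hv
    · intro x hx y hy
      have hx' : x ∈ (BallTree.node c l r).leaves := Multiset.mem_add.2 (.inl hx)
      have hy' : y ∈ (BallTree.node c l r).leaves := Multiset.mem_add.2 (.inl hy)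
      exact hdiam x y (hz x hx' y hy') (BallTree.dist_le_two_mul_radius hx' hy')
    rcases Multiset.mem_cons.1 hv with rfl | hv
    · intro x hx y hy
      have hx' : x ∈ (BallTree.node c l r).leaves := Multiset.mem_add.2 (.inr hx)
      have hy' : y ∈ (BallTree.node c l r).leaves := Multiset.mem_add.2 (.inr hy)
      exact hdiam x y (hz x hx' y hy') (BallTree.dist_le_two_mul_radius hx' hy')
    · intro x hx y hy
      refine hdiam x y (h.diam v (Multiset.mem_cons_of_mem hv) x hx y hy) ?_
      linarith [BallTree.dist_le_two_mul_radius hx hy, hmax v hv]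

end HeapInv

theorem HeapInv.of_roots {X : Type u} [MetricSpace X] {α : ℝ} (hα : 1 < α) {A B : Finset X}
    {GA GB : BallTree X} (hGA : IsGreedyTree α A GA) (hGB : IsGreedyTree α B GB) :
    ∃ p ρ, HeapInv A B p (α ^ 3 / (α - 1)) ρ {⟨Side.inA, GA⟩, ⟨Side.inB, GB⟩} := by
  obtain ⟨pA, hcA, hsA⟩ := hGA.exists_spread hα
  obtain ⟨pB, hcB, hsB⟩ := hGB.exists_spread hα
  have hκ : 0 < α ^ 3 / (α - 1) := div_pos (by positivity) (by linarith)
  set κ := α ^ 3 / (α - 1)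
  -- Any `ρ` is admissible for separation, both roots having index 0; this one makes `2 * κ * ρ` the
  -- sum of the two root diameter bounds.
  refine ⟨fun s => match s with | .inA => pA | .inB => pB, (GA.radius + GB.radius) / κ,
    ?_, ?_, ?_, ?_⟩
  · simp [Multiset.insert_eq_cons, Multiset.cons_bind, Vertex.points, labelled, hGA.leaves_eq,
      hGB.leaves_eq]
  · simp [Multiset.insert_eq_cons, hsA, hsB]
  · simp only [Multiset.insert_eq_cons, Multiset.mem_cons, Multiset.mem_singleton,
      forall_eq_or_imp, forall_eq]
    exact ⟨⟨0, hcA, .inl rfl⟩, ⟨0, hcB, .inl rfl⟩⟩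
  · have e : 2 * κ * ((GA.radius + GB.radius) / κ) = 2 * GA.radius + 2 * GB.radius := by
      field_simp
    simp only [Multiset.insert_eq_cons, Multiset.mem_cons, Multiset.mem_singleton,
      forall_eq_or_imp, forall_eq, e]
    have := GA.radius_nonneg
    have := GB.radius_nonneg
    exact ⟨fun x hx y hy => by linarith [BallTree.dist_le_two_mul_radius hx hy],
      fun x hx y hy => by linarith [BallTree.dist_le_two_mul_radius hx hy]⟩

theorem Comp.bind_memory {X : Type u} {β : Type v} {γ : Type w} (m : Comp X β)
    (f : β → Comp X γ) (M : Memory X) : ((m ≫= f) M).2.1 = (f (m M).1 (m M).2.1).2.1 := rfl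

theorem Comp.bind_cost {X : Type u} {β : Type v} {γ : Type w} (m : Comp X β)
    (f : β → Comp X γ) (M : Memory X) :
    ((m ≫= f) M).2.2 = (m M).2.2 + (f (m M).1 (m M).2.1).2.2 := rfl

/-! ### The invariant of the viability graph -/

theorem Side.eq_of_ne_of_ne {s t r : Side} (h : s ≠ t) (h' : r ≠ t) : s = r := by
  cases s <;> cases t <;> cases r <;> simp_all

theorem Side.eq_inB_of_ne {s : Side} (h : Side.inA ≠ s) : s = .inB := by
  cases s <;> simp_all

/-- The invariant of the viability graph on the heap `H`, except that the nodes in `U` need not be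
pruned and the lower bounds of the nodes in `U'` need not be accounted for. -/
structure GraphInv {X : Type u} [MetricSpace X] (A B : Finset X) (H : Multiset (Vertex X))
    (U U' : Vertex X → Prop) (M : Memory X) : Prop where
  adj_eq_nil : ∀ v, v ∉ H → M.adj v = []
  symm : ∀ v w, w ∈ M.adj v → v ∈ M.adj w
  side_ne : ∀ v w, w ∈ M.adj v → v.side ≠ w.side
  nodup : ∀ v, (M.adj v).Nodup
  cover : ∀ x ∈ H, x.side = .inA → ∀ a ∈ x.tree.leaves, ∀ b ∈ B,
    (∀ b' ∈ B, dist a b ≤ dist a b') → ∃ y ∈ M.adj x, b ∈ y.tree.leaves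
  pruned : ∀ x ∈ H, x.side = .inA → ¬ U x → ∀ y ∈ M.adj x, ∀ y' ∈ M.adj x,
    dist x.tree.center y.tree.center - y.tree.radius ≤
      dist x.tree.center y'.tree.center + 2 * x.tree.radius
  low : ∀ x ∈ H, x.side = .inA → ¬ U' x → ∃ y ∈ M.adj x,
    dist x.tree.center y.tree.center - y.tree.radius ≤ M.best
  best_nonneg : 0 ≤ M.best
  best_le : ∃ a ∈ A, ∀ b ∈ B, M.best ≤ dist a b

namespace GraphInv

theorem mem_of_mem_adj {X : Type u} [MetricSpace X] {A B : Finset X} {H : Multiset (Vertex X)}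
    {U U' : Vertex X → Prop} {M : Memory X} (h : GraphInv A B H U U' M) {v w : Vertex X}
    (hw : w ∈ M.adj v) : w ∈ H := by
  by_contra hH
  have := h.symm v w hw
  rw [h.adj_eq_nil w hH] at this
  simp at this

/-- Needed because `minOver` returns the default 0 on an empty list. -/
theorem adj_ne_nil {X : Type u} [MetricSpace X] {A B : Finset X} (hB : B.Nonempty)
    {p : Side → ℕ → X} {κ ρ : ℝ} {H : Multiset (Vertex X)} (hH : HeapInv A B p κ ρ H)
    {U U' : Vertex X → Prop} {M : Memory X} (h : GraphInv A B H U U' M) {x : Vertex X}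
    (hx : x ∈ H) (hs : x.side = .inA) : M.adj x ≠ [] := by
  obtain ⟨b, hb, hmin⟩ := B.exists_min_image (dist x.tree.center) hB
  obtain ⟨y, hy, -⟩ := h.cover x hx hs _ (hH.center_mem hx) b hb hmin
  exact List.ne_nil_of_mem hy

/-- The new bound is witnessed by the center of `x`: a nearest point of `B` to it lies below some
neighbour `y'`, so the gap of `y'`, and hence the minimum, is at most that distance. -/
theorem updateLow {X : Type u} [MetricSpace X] {A B : Finset X} (hB : B.Nonempty)
    {p : Side → ℕ → X} {κ ρ : ℝ} {H : Multiset (Vertex X)} (hH : HeapInv A B p κ ρ H)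
    {U U' V : Vertex X → Prop} {M : Memory X} (h : GraphInv A B H U U' M) {x : Vertex X}
    (hx : x ∈ H) (hs : x.side = .inA) (hV : ∀ v, U' v → v = x ∨ V v) :
    GraphInv A B H U V (Hausdorff.updateLow x M).2.1 ∧
      (Hausdorff.updateLow x M).2.1.adj = M.adj ∧
      (Hausdorff.updateLow x M).2.2 ≤ 7 * (M.adj x).length + 6 := by
  obtain ⟨y, hy, hmin, hadj, hbest, hcost⟩ :=
    Hausdorff.updateLow_run x M (h.adj_ne_nil hB hH hx hs)
  refine ⟨⟨?_, ?_, ?_, ?_, ?_, ?_, ?_, ?_, ?_⟩, hadj, hcost⟩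
  · rw [hadj]; exact h.adj_eq_nil
  · rw [hadj]; exact h.symm
  · rw [hadj]; exact h.side_ne
  · rw [hadj]; exact h.nodup
  · rw [hadj]; exact h.cover
  · rw [hadj]; exact h.pruned
  · rw [hadj, hbest]
    intro x' hx' hs' hV'
    by_cases he : x' = x
    · subst he
      exact ⟨y, hy, (le_max_left _ _).trans (le_max_right _ _)⟩
    · obtain ⟨y', hy', hle⟩ := h.low x' hx' hs' fun hU => hV' ((hV x' hU).resolve_left he)
      exact ⟨y', hy', hle.trans (le_max_left _ _)⟩
  · rw [hbest]
    exact h.best_nonneg.trans (le_max_left _ _)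
  · rw [hbest]
    rcases max_choice M.best (max (dist x.tree.center y.tree.center - y.tree.radius) 0) with e | e
    · rw [e]; exact h.best_le
    rw [e]
    refine ⟨x.tree.center, hH.center_mem_A hx hs, ?_⟩
    obtain ⟨b, hb, hbmin⟩ := B.exists_min_image (dist x.tree.center) hB
    obtain ⟨y', hy', hby⟩ := h.cover x hx hs _ (hH.center_mem hx) b hb hbmin
    intro b' hb'
    refine (max_le ((hmin y' hy').trans ?_) dist_nonneg).trans (hbmin b' hb')
    have h1 := dist_triangle_right x.tree.center y'.tree.center b
    have h2 := BallTree.dist_center_le_radius hby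
    linarith

/-- Removing edges cannot violate `pruned` elsewhere, and no other node on the `A` side loses a
neighbour. The lower bound of `x` may become stale; it stays exempt until `updateLow` is run. -/
theorem prune {X : Type u} [MetricSpace X] {A B : Finset X} (hB : B.Nonempty)
    {p : Side → ℕ → X} {κ ρ : ℝ} {H : Multiset (Vertex X)} (hH : HeapInv A B p κ ρ H)
    {U V : Vertex X → Prop} {M : Memory X} (h : GraphInv A B H U U M) {x : Vertex X}
    (hx : x ∈ H) (hs : x.side = .inA) (hUx : U x) (hV : ∀ v, U v → v = x ∨ V v) {D : ℕ}
    (hD : ∀ v, (M.adj v).length ≤ D) :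
    GraphInv A B H V U (Hausdorff.prune x M).2.1 ∧
      (∀ v, ((Hausdorff.prune x M).2.1.adj v).length ≤ D) ∧
      (Hausdorff.prune x M).2.2 ≤ (3 * D + 15) * D + 6 := by
  classical
  obtain ⟨y', hy', hmin, hbest, hadj, hcost⟩ :=
    Hausdorff.prune_run x D M hD (h.adj_ne_nil hB hH hx hs)
  set M' := (Hausdorff.prune x M).2.1
  set t := dist x.tree.center y'.tree.center + 2 * x.tree.radius with ht
  have hmem : ∀ v w, w ∈ M'.adj v ↔ w ∈ M.adj v ∧
      (v = x → dist x.tree.center w.tree.center - w.tree.radius ≤ t) ∧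
      (w = x → dist x.tree.center v.tree.center - v.tree.radius ≤ t) := by
    intro v w
    rw [hadj]
    by_cases hv : v = x
    · subst hv
      rw [if_pos rfl, List.mem_filter, decide_eq_true_eq]
      have : w ∈ M.adj v → w ≠ v := fun hw e => h.side_ne v w hw (by rw [e])
      tauto
    · rw [if_neg hv]
      split_ifs with hc
      · rw [List.mem_filter, decide_eq_true_eq]
        have := hc.2.not_ge
        tauto
      · have : w = x → w ∈ M.adj v → v ∈ M.adj x := fun e hw => e ▸ h.symm v w hw
        rw [not_and, not_lt] at hc
        tauto
  refine ⟨⟨?_, ?_, ?_, ?_, ?_, ?_, ?_, ?_, ?_⟩, ?_, hcost⟩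
  · intro v hv
    refine List.eq_nil_iff_forall_not_mem.2 fun w hw => ?_
    have := ((hmem v w).1 hw).1
    rw [h.adj_eq_nil v hv] at this
    simp at this
  · intro v w hw
    rw [hmem] at hw ⊢
    exact ⟨h.symm v w hw.1, hw.2.2, hw.2.1⟩
  · exact fun v w hw => h.side_ne v w ((hmem v w).1 hw).1
  · intro v
    rw [hadj]
    split_ifs
    · exact (h.nodup x).filter _
    · exact (h.nodup v).filter _
    · exact h.nodup v
  · intro x₁ hx₁ hs₁ a ha b hb hbmin
    obtain ⟨y, hy, hby⟩ := h.cover x₁ hx₁ hs₁ a ha b hb hbmin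
    refine ⟨y, (hmem x₁ y).2 ⟨hy, ?_, ?_⟩, hby⟩
    -- Going from the center of `x₁` through `a` and its nearest point `b` to the center of `y`
    -- costs at most `radius x₁ + dist a b + radius y`. As the center of `y'` lies in `B`, `dist a
    -- b` is at most its distance to the center of `x₁` plus another `radius x₁`. So this edge
    -- survives.
    · rintro rfl
      have hy'B : y'.tree.center ∈ B := hH.center_mem_B (h.mem_of_mem_adj hy')
        (Side.eq_inB_of_ne (hs ▸ h.side_ne x₁ y' hy'))
      have h1 := hbmin _ hy'B
      have h2 := BallTree.dist_center_le_radius ha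
      have h3 := BallTree.dist_center_le_radius hby
      have h4 := dist_triangle4 x₁.tree.center a b y.tree.center
      have h5 := dist_triangle_left a y'.tree.center x₁.tree.center
      rw [dist_comm b] at h4
      linarith
    · rintro rfl
      exact absurd (hs₁.trans hs.symm) (h.side_ne x₁ y hy)
  · intro x₁ hx₁ hs₁ hV₁ y₁ hy₁ y₂ hy₂
    by_cases he : x₁ = x
    · subst he
      have h1 := ((hmem _ _).1 hy₁).2.1 rfl
      have h2 := hmin y₂ ((hmem _ _).1 hy₂).1
      linarith
    · exact h.pruned x₁ hx₁ hs₁ (fun hU => hV₁ ((hV x₁ hU).resolve_left he)) y₁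
        ((hmem _ _).1 hy₁).1 y₂ ((hmem _ _).1 hy₂).1
  · intro x₁ hx₁ hs₁ hU₁
    obtain ⟨y, hy, hle⟩ := h.low x₁ hx₁ hs₁ hU₁
    refine ⟨y, (hmem _ _).2 ⟨hy, fun e => absurd hUx (e ▸ hU₁), ?_⟩, hbest ▸ hle⟩
    rintro rfl
    exact absurd (hs₁.trans hs.symm) (h.side_ne x₁ y hy)
  · exact hbest ▸ h.best_nonneg
  · exact hbest ▸ h.best_le
  · intro v
    rw [hadj]
    split_ifs
    · exact (List.length_filter_le _ _).trans (hD x)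
    · exact (List.length_filter_le _ _).trans (hD v)
    · exact hD v

/-- Pruning and updating all the affected nodes restores the invariant. -/
theorem forEach {X : Type u} [MetricSpace X] {A B : Finset X} (hB : B.Nonempty)
    {p : Side → ℕ → X} {κ ρ : ℝ} {H : Multiset (Vertex X)} (hH : HeapInv A B p κ ρ H)
    {S : List (Vertex X)} (hS : ∀ x ∈ S, x ∈ H ∧ x.side = .inA) {M : Memory X}
    (h : GraphInv A B H (· ∈ S) (· ∈ S) M) {D : ℕ} (hD : ∀ v, (M.adj v).length ≤ D) :
    GraphInv A B H (fun _ => False) (fun _ => False) (Hausdorff.forEach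
      (fun x => Hausdorff.prune x ≫= fun _ => Hausdorff.updateLow x) S M).2.1 ∧
    (Hausdorff.forEach (fun x => Hausdorff.prune x ≫= fun _ => Hausdorff.updateLow x) S M).2.2 ≤
      ((3 * D + 22) * D + 13) * S.length + 1 := by
  obtain ⟨⟨-, h1, -⟩, h2⟩ := Hausdorff.forEach_rule
    (f := fun x => Hausdorff.prune x ≫= fun _ => Hausdorff.updateLow x)
    (k := (3 * D + 22) * D + 12)
    (fun vs N => (∀ x ∈ vs, x ∈ H ∧ x.side = .inA) ∧ GraphInv A B H (· ∈ vs) (· ∈ vs) N ∧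
      ∀ v, (N.adj v).length ≤ D)
    (by
      rintro x vs N ⟨n1, n2, n3⟩
      obtain ⟨hx, hs⟩ := n1 x (by simp)
      obtain ⟨i1, i2, i3⟩ := n2.prune hB hH hx hs (V := (· ∈ vs)) (by simp) (by simp) n3
      obtain ⟨j1, j2, j3⟩ := i1.updateLow hB hH hx hs (V := (· ∈ vs)) (by simp)
      simp only [Comp.bind_memory, Comp.bind_cost]
      refine ⟨⟨fun v hv => n1 v (by simp [hv]), j1, fun v => ?_⟩, ?_⟩
      · rw [j2]
        exact i2 v
      · have := i2 x
        linarith)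
    S M ⟨hS, h, hD⟩
  exact ⟨by simpa using h1, h2⟩

/-- `V` exempts the nodes on the `A` side whose adjacency list is new: the children themselves if
`z` is in the tree on `A`, the neighbours of `z` otherwise. -/
theorem split {X : Type u} [MetricSpace X] {A B : Finset X}
    {p : Side → ℕ → X} {κ ρ ρ' : ℝ} {H : Multiset (Vertex X)} {s : Side} {c : X}
    {l r : BallTree X} (hH : HeapInv A B p κ ρ (⟨s, .node c l r⟩ ::ₘ H))
    (hH' : HeapInv A B p κ ρ' (⟨s, l⟩ ::ₘ ⟨s, r⟩ ::ₘ H)) {M : Memory X}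
    (h : GraphInv A B (⟨s, .node c l r⟩ ::ₘ H) (fun _ => False) (fun _ => False) M)
    {V : Vertex X → Prop} (hV : ∀ x, s = .inA → (x = ⟨s, l⟩ ∨ x = ⟨s, r⟩) → V x)
    (hV' : s = .inB → ∀ x ∈ M.adj ⟨s, .node c l r⟩, V x) {D : ℕ}
    (hD : ∀ v, (M.adj v).length ≤ D) :
    (Hausdorff.splitVertex ⟨s, .node c l r⟩ ⟨s, l⟩ ⟨s, r⟩ M).1 = M.adj ⟨s, .node c l r⟩ ∧
    GraphInv A B (⟨s, l⟩ ::ₘ ⟨s, r⟩ ::ₘ H) V V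
      (Hausdorff.splitVertex ⟨s, .node c l r⟩ ⟨s, l⟩ ⟨s, r⟩ M).2.1 ∧
    (∀ v, ((Hausdorff.splitVertex ⟨s, .node c l r⟩ ⟨s, l⟩ ⟨s, r⟩ M).2.1.adj v).length ≤ D + 2) ∧
    (Hausdorff.splitVertex ⟨s, .node c l r⟩ ⟨s, l⟩ ⟨s, r⟩ M).2.2 ≤ (3 * D + 6) * D + 5 := by
  classical
  have hnd' := hH'.nodup
  rw [Multiset.nodup_cons, Multiset.nodup_cons, Multiset.mem_cons, not_or] at hnd'
  obtain ⟨⟨hlr, hlH⟩, hrH, -⟩ := hnd'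
  have hzH := (Multiset.nodup_cons.1 hH.nodup).1
  have hzl : (⟨s, .node c l r⟩ : Vertex X) ≠ ⟨s, l⟩ := fun e =>
    BallTree.node_ne_left c l r (congrArg Vertex.tree e)
  have hzr : (⟨s, .node c l r⟩ : Vertex X) ≠ ⟨s, r⟩ := fun e =>
    BallTree.node_ne_right c l r (congrArg Vertex.tree e)
  have hsl : (⟨s, l⟩ : Vertex X).side = s := rfl
  have hsr : (⟨s, r⟩ : Vertex X).side = s := rfl
  have hsz : (⟨s, .node c l r⟩ : Vertex X).side = s := rfl
  have hleaves : (⟨s, .node c l r⟩ : Vertex X).tree.leaves = l.leaves + r.leaves := rfl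
  set z : Vertex X := ⟨s, .node c l r⟩
  set zl : Vertex X := ⟨s, l⟩
  set zr : Vertex X := ⟨s, r⟩
  have hside : ∀ v ∈ M.adj z, v.side ≠ s := fun v hv => (h.side_ne z v hv).symm
  have hlz : zl ∉ M.adj z := fun hm => hside zl hm hsl
  have hrz : zr ∉ M.adj z := fun hm => hside zr hm hsr
  obtain ⟨h1, hbest, hadj, hcost⟩ := Hausdorff.splitVertex_run z zl zr D M hD (h.nodup z) hlz hrz
  set M' := (Hausdorff.splitVertex z zl zr M).2.1
  have hH_of : ∀ v w, w ∈ M.adj v → w ≠ z → w ∈ H := fun v w hw hne =>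
    (Multiset.mem_cons.1 (h.mem_of_mem_adj hw)).resolve_left hne
  have hne : ∀ v ∈ H, v ≠ z ∧ v ≠ zl ∧ v ≠ zr := fun v hv =>
    ⟨fun e => hzH (e ▸ hv), fun e => hlH (e ▸ hv), fun e => hrH (e ▸ hv)⟩
  have hadjz : M'.adj z = [] := by rw [hadj, if_pos rfl]
  have hadjl : M'.adj zl = M.adj z := by
    rw [hadj, if_neg hzl.symm, if_neg hlz, if_pos (.inl rfl)]
  have hadjr : M'.adj zr = M.adj z := by
    rw [hadj, if_neg hzr.symm, if_neg hrz, if_pos (.inr rfl)]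
  have hadjn : ∀ v ∈ M.adj z, M'.adj v = zl :: zr :: (M.adj v).filter (· ≠ z) := fun v hv => by
    rw [hadj, if_neg (fun e => hside v hv (by rw [e])), if_pos hv]
  have hadjo : ∀ v, v ≠ z → v ≠ zl → v ≠ zr → v ∉ M.adj z → M'.adj v = M.adj v :=
    fun v h1 h2 h3 h4 => by rw [hadj, if_neg h1, if_neg h4, if_neg (by tauto)]
  have hout : ∀ v, v ∉ zl ::ₘ zr ::ₘ H → v ≠ z → M.adj v = [] := fun v hv hvz =>
    h.adj_eq_nil v fun hm => hv (Multiset.mem_cons_of_mem (Multiset.mem_cons_of_mem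
      ((Multiset.mem_cons.1 hm).resolve_left hvz)))
  -- Outside `V` nothing changes on the `A` side, so `pruned` and `low` carry over verbatim.
  have hclean : ∀ x ∈ zl ::ₘ zr ::ₘ H, x.side = .inA → ¬ V x →
      x ∈ z ::ₘ H ∧ M'.adj x = M.adj x := by
    intro x hx hs hVx
    have hxl : x ≠ zl := fun e => hVx (hV x (by rw [← hsl, ← e, hs]) (.inl e))
    have hxr : x ≠ zr := fun e => hVx (hV x (by rw [← hsr, ← e, hs]) (.inr e))
    have hxH : x ∈ H := by simpa [hxl, hxr] using hx
    refine ⟨Multiset.mem_cons_of_mem hxH, hadjo x (hne x hxH).1 hxl hxr fun hxn => hVx ?_⟩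
    exact hV' (Side.eq_inB_of_ne (hs ▸ hside x hxn)) x hxn
  refine ⟨h1, ⟨?_, ?_, ?_, ?_, ?_, ?_, ?_, ?_, ?_⟩, ?_, hcost⟩
  · intro v hv
    by_cases hvz : v = z
    · rw [hvz, hadjz]
    · rw [hadjo v hvz (fun e => hv (by simp [e])) (fun e => hv (by simp [e])), hout v hv hvz]
      intro hvn
      have := hH_of z v hvn hvz
      exact hv (by simp [this])
  · intro v w hw
    by_cases hvz : v = z
    · rw [hvz, hadjz] at hw
      simp at hw
    by_cases hvn : v ∈ M.adj z
    · rw [hadjn v hvn] at hw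
      simp only [List.mem_cons, List.mem_filter, decide_eq_true_eq] at hw
      rcases hw with rfl | rfl | ⟨hw, hwz⟩
      · rwa [hadjl]
      · rwa [hadjr]
      · have hwH := hne w (hH_of v w hw hwz)
        have hwn : w ∉ M.adj z := fun hwn =>
          h.side_ne v w hw (Side.eq_of_ne_of_ne (hside v hvn) (hside w hwn))
        rw [hadjo w hwz hwH.2.1 hwH.2.2 hwn]
        exact h.symm v w hw
    by_cases hvl : v = zl
    · subst hvl
      rw [hadjl] at hw
      rw [hadjn w hw]
      simp
    by_cases hvr : v = zr
    · subst hvr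
      rw [hadjr] at hw
      rw [hadjn w hw]
      simp
    rw [hadjo v hvz hvl hvr hvn] at hw
    have hwz : w ≠ z := fun e => hvn (e ▸ h.symm v w hw)
    have hwH := hne w (hH_of v w hw hwz)
    have hvw := h.symm v w hw
    by_cases hwn : w ∈ M.adj z
    · rw [hadjn w hwn]
      simp [hvw, hvz]
    · rwa [hadjo w hwz hwH.2.1 hwH.2.2 hwn]
  · intro v w hw
    by_cases hvz : v = z
    · rw [hvz, hadjz] at hw
      simp at hw
    by_cases hvn : v ∈ M.adj z
    · rw [hadjn v hvn] at hw
      simp only [List.mem_cons, List.mem_filter, decide_eq_true_eq] at hw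
      rcases hw with rfl | rfl | ⟨hw, hwz⟩
      · exact hside v hvn
      · exact hside v hvn
      · exact h.side_ne v w hw
    by_cases hvl : v = zl
    · subst hvl
      rw [hadjl] at hw
      exact (hside w hw).symm
    by_cases hvr : v = zr
    · subst hvr
      rw [hadjr] at hw
      exact (hside w hw).symm
    rw [hadjo v hvz hvl hvr hvn] at hw
    exact h.side_ne v w hw
  · intro v
    rw [hadj]
    split_ifs with _ hvn
    · exact List.nodup_nil
    · have hno : ∀ w, w ∉ H → w ∉ (M.adj v).filter (· ≠ z) := fun w hw hm => by
        rw [List.mem_filter, decide_eq_true_eq] at hm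
        exact hw (hH_of v w hm.1 hm.2)
      rw [List.nodup_cons, List.nodup_cons, List.mem_cons, not_or]
      exact ⟨⟨hlr, hno zl hlH⟩, hno zr hrH, (h.nodup v).filter _⟩
    · exact h.nodup z
    · exact h.nodup v
  · intro x hx hs a ha b hb hbmin
    rcases Multiset.mem_cons.1 hx with rfl | hx
    · rw [hadjl]
      exact h.cover z (Multiset.mem_cons_self _ _) hs a
        (hleaves ▸ Multiset.mem_add.2 (.inl ha)) b hb hbmin
    rcases Multiset.mem_cons.1 hx with rfl | hx
    · rw [hadjr]
      exact h.cover z (Multiset.mem_cons_self _ _) hs a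
        (hleaves ▸ Multiset.mem_add.2 (.inr ha)) b hb hbmin
    obtain ⟨y, hy, hby⟩ := h.cover x (Multiset.mem_cons_of_mem hx) hs a ha b hb hbmin
    have hxne := hne x hx
    by_cases hxn : x ∈ M.adj z
    · rw [hadjn x hxn]
      by_cases hyz : y = z
      · rw [hyz, hleaves, Multiset.mem_add] at hby
        rcases hby with hb | hb
        · exact ⟨zl, by simp, hb⟩
        · exact ⟨zr, by simp, hb⟩
      · exact ⟨y, by simp [hy, hyz], hby⟩
    · rw [hadjo x hxne.1 hxne.2.1 hxne.2.2 hxn]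
      exact ⟨y, hy, hby⟩
  · intro x hx hs hVx
    obtain ⟨hx', e⟩ := hclean x hx hs hVx
    rw [e]
    exact h.pruned x hx' hs id
  · intro x hx hs hVx
    obtain ⟨hx', e⟩ := hclean x hx hs hVx
    rw [e, hbest]
    exact h.low x hx' hs id
  · exact hbest ▸ h.best_nonneg
  · exact hbest ▸ h.best_le
  -- Two entries are prepended; the removal of `z` is not counted, hence `D + 2`.
  · intro v
    rw [hadj]
    have h1 := hD v
    have h2 := hD z
    have h3 := List.length_filter_le (· ≠ z) (M.adj v)
    split_ifs
    · simp
    · simp only [List.length_cons]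
      omega
    · omega
    · omega

end GraphInv

/-! ### Accuracy and degree bounds from the invariant -/

namespace GraphInv

theorem exists_dist_le {X : Type u} [MetricSpace X] {A B : Finset X} {p : Side → ℕ → X}
    {κ ρ : ℝ} {H : Multiset (Vertex X)} (hH : HeapInv A B p κ ρ H) {U : Vertex X → Prop}
    {M : Memory X} (h : GraphInv A B H U (fun _ => False) M) {r : ℝ}
    (hr : ∀ v ∈ H, v.tree.radius ≤ r) {a : X} (ha : a ∈ A) :
    ∃ b ∈ B, dist a b ≤ M.best + 2 * r := by
  obtain ⟨x, hx, hs, hax⟩ := hH.mem_labelled.1 (mem_labelled_inA.2 ha)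
  obtain ⟨y, hy, hle⟩ := h.low x hx hs id
  have hyH := h.mem_of_mem_adj hy
  refine ⟨y.tree.center, hH.center_mem_B hyH (Side.eq_inB_of_ne (hs ▸ h.side_ne x y hy)), ?_⟩
  have h1 := BallTree.dist_center_le_radius hax
  have h2 := dist_triangle_left a y.tree.center x.tree.center
  linarith [hr x hx, hr y hyH]

/-- Compare with the neighbour `y'` that realizes the lower bound: its center is within `M.best + r`
of `x`, and pruning leaves only neighbours at most `3 * r` farther away than that. -/
theorem dist_center_le {X : Type u} [MetricSpace X] {A B : Finset X} {H : Multiset (Vertex X)}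
    {M : Memory X} (h : GraphInv A B H (fun _ => False) (fun _ => False) M) {r : ℝ}
    (hr : ∀ v ∈ H, v.tree.radius ≤ r) {v w : Vertex X} (hw : w ∈ M.adj v) :
    dist w.tree.center v.tree.center ≤ M.best + 4 * r := by
  have key : ∀ x y, x.side = .inA → y ∈ M.adj x →
      dist x.tree.center y.tree.center ≤ M.best + 4 * r := by
    intro x y hs hy
    have hx := h.mem_of_mem_adj (h.symm x y hy)
    obtain ⟨y', hy', hle⟩ := h.low x hx hs id
    have h1 := h.pruned x hx hs id y hy y' hy'
    linarith [hr x hx, hr y (h.mem_of_mem_adj hy), hr y' (h.mem_of_mem_adj hy')]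
  cases hv : v.side with
  | inA =>
    rw [dist_comm]
    exact key v w hv hw
  | inB =>
    refine key w v ?_ (h.symm v w hw)
    have := h.side_ne v w hw
    cases hws : w.side with
    | inA => rfl
    | inB => exact absurd (hv.trans hws.symm) this

/-- The neighbours lie on one side, so their centers are `r / (2 * κ)`-separated, and they lie
within `(2 / ε + 4) * r` of the center of `v`. The ratio `2 * κ * (2 / ε + 4)` of these radii enters
the packing bound. -/
theorem length_adj_le {X : Type u} [MetricSpace X] {d : ℝ} (hd : HalfRadiusCover X d)
    (hd0 : 0 ≤ d) {A B : Finset X} {p : Side → ℕ → X} {κ ρ : ℝ} (hκ : 1 ≤ κ)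
    {H : Multiset (Vertex X)} (hH : HeapInv A B p κ ρ H) {M : Memory X}
    (h : GraphInv A B H (fun _ => False) (fun _ => False) M) {r ε : ℝ} (hε : 0 < ε) (hr0 : 0 < r)
    (hr : ∀ v ∈ H, v.tree.radius ≤ r) (hrρ : r ≤ 2 * κ * ρ) (hbest : ε * M.best / 2 < r)
    (v : Vertex X) : ((M.adj v).length : ℝ) ≤ (16 * κ * (2 + 1 / ε)) ^ d := by
  classical
  have hκ0 : 0 < κ := by linarith
  have hρ : r / (2 * κ) ≤ ρ := by rwa [div_le_iff₀' (by positivity)]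
  have hs0 : 0 < r / (2 * κ) := by positivity
  have hsep : ∀ w ∈ M.adj v, ∀ w' ∈ M.adj v, w ≠ w' →
      r / (2 * κ) ≤ dist w.tree.center w'.tree.center := fun w hw w' hw' hne =>
    hρ.trans (hH.separated (h.mem_of_mem_adj hw) (h.mem_of_mem_adj hw')
      (Side.eq_of_ne_of_ne (h.side_ne v w hw).symm (h.side_ne v w' hw').symm) hne)
  have hinj : ∀ w ∈ M.adj v, ∀ w' ∈ M.adj v, w.tree.center = w'.tree.center → w = w' := by
    intro w hw w' hw' e
    by_contra hne
    have := hsep w hw w' hw' hne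
    rw [e, dist_self] at this
    linarith
  have hcard : (M.adj v).length =
      ((M.adj v).toFinset.image fun w => w.tree.center).card := by
    rw [Finset.card_image_of_injOn, List.toFinset_card_of_nodup (h.nodup v)]
    intro w hw w' hw' e
    exact hinj w (by simpa using hw) w' (by simpa using hw') e
  have hq : 16 * κ * (2 + 1 / ε) = 4 * (2 * κ * (2 / ε + 4)) := by ring
  have hε' : 0 < 2 / ε := by positivity
  have hL : M.best ≤ 2 / ε * r := by
    rw [div_mul_eq_mul_div, le_div_iff₀ hε]
    linarith
  rw [hcard, hq]
  refine hd.card_le_of_separated hd0 (c := v.tree.center) (r := (2 / ε + 4) * r)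
    (s := r / (2 * κ)) (by positivity) hs0 (by nlinarith) (le_of_eq (by field_simp)) ?_ ?_
  · intro x hx
    simp only [Finset.mem_image, List.mem_toFinset] at hx
    obtain ⟨w, hw, rfl⟩ := hx
    linarith [h.dist_center_le hr hw]
  · intro x hx y hy hxy
    simp only [Finset.mem_image, List.mem_toFinset] at hx hy
    obtain ⟨w, hw, rfl⟩ := hx
    obtain ⟨w', hw', rfl⟩ := hy
    exact hsep w hw w' hw' fun e => hxy (by rw [e])

end GraphInv

/-! ### The main loop -/

namespace Hausdorff

theorem mainLoop_cons_finished {X : Type u} [MetricSpace X] {ε : ℝ} {z : Vertex X}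
    {zs : List (Vertex X)} {M : Memory X} (h : z.tree.radius ≤ ε * M.best / 2) :
    mainLoop ε (z :: zs) M = (M.best, M, 6) := by
  simp [mainLoop, Comp.bind, tick, Comp.query, Comp.instr, getRadius, getBest, mul, half, atMost, h,
    Comp.ret]

/-- One iteration of the main loop. -/
noncomputable def iteration {X : Type u} [MetricSpace X] (z zl zr : Vertex X) : Comp X Unit :=
  splitVertex z zl zr ≫= fun ns => affected z zl zr ns ≫= fun S =>
    forEach (fun x => prune x ≫= fun _ => updateLow x) S

theorem mainLoop_cons_step {X : Type u} [MetricSpace X] {ε : ℝ} {s : Side} {c : X}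
    {l r : BallTree X} {zs : List (Vertex X)} {M : Memory X}
    (h : ε * M.best / 2 < (BallTree.node c l r).radius) :
    (mainLoop ε (⟨s, .node c l r⟩ :: zs) M).1 =
      (mainLoop ε zs (iteration ⟨s, .node c l r⟩ ⟨s, l⟩ ⟨s, r⟩ M).2.1).1 ∧
    (mainLoop ε (⟨s, .node c l r⟩ :: zs) M).2.2 =
      (iteration ⟨s, .node c l r⟩ ⟨s, l⟩ ⟨s, r⟩ M).2.2 +
        (mainLoop ε zs (iteration ⟨s, .node c l r⟩ ⟨s, l⟩ ⟨s, r⟩ M).2.1).2.2 + 7 := by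
  have hq : atMost (BallTree.node c l r).radius (ε * M.best / 2) M = (false, M, 1) := by
    simp [atMost, Comp.query, Comp.instr, h]
  simp [mainLoop, iteration, Comp.bind, tick, Comp.query, Comp.instr, getRadius, getBest, mul,
    half, hq, getChildren]
  ring

theorem affected_run {X : Type u} (s : Side) (t l r : BallTree X) (ns : List (Vertex X))
    (M : Memory X) :
    (affected ⟨s, t⟩ ⟨s, l⟩ ⟨s, r⟩ ns M).1 =
      (match s with | .inA => [⟨s, l⟩, ⟨s, r⟩] | .inB => ns) ∧
    (affected ⟨s, t⟩ ⟨s, l⟩ ⟨s, r⟩ ns M).2.1 = M ∧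
    (affected ⟨s, t⟩ ⟨s, l⟩ ⟨s, r⟩ ns M).2.2 ≤ 3 := by
  cases s
  · exact ⟨rfl, rfl, le_rfl⟩
  · exact ⟨rfl, rfl, show 1 ≤ 3 by omega⟩

theorem iteration_run {X : Type u} [MetricSpace X] {A B : Finset X} (hB : B.Nonempty)
    {p : Side → ℕ → X} {κ ρ ρ' : ℝ} {H : Multiset (Vertex X)} {s : Side} {c : X}
    {l r : BallTree X} (hH : HeapInv A B p κ ρ (⟨s, .node c l r⟩ ::ₘ H))
    (hH' : HeapInv A B p κ ρ' (⟨s, l⟩ ::ₘ ⟨s, r⟩ ::ₘ H)) {M : Memory X}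
    (h : GraphInv A B (⟨s, .node c l r⟩ ::ₘ H) (fun _ => False) (fun _ => False) M) {D : ℕ}
    (hD : ∀ v, (M.adj v).length ≤ D) :
    GraphInv A B (⟨s, l⟩ ::ₘ ⟨s, r⟩ ::ₘ H) (fun _ => False) (fun _ => False)
      (iteration ⟨s, .node c l r⟩ ⟨s, l⟩ ⟨s, r⟩ M).2.1 ∧
    (iteration ⟨s, .node c l r⟩ ⟨s, l⟩ ⟨s, r⟩ M).2.2 + 7 ≤ 30 * (D + 2) ^ 3 := by
  obtain ⟨S, hS⟩ : ∃ S : List (Vertex X), S = (match (generalizing := false) s with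
    | .inA => [⟨s, l⟩, ⟨s, r⟩] | .inB => M.adj ⟨s, .node c l r⟩) := ⟨_, rfl⟩
  obtain ⟨h1, h2, h3, h4⟩ := h.split hH hH' (V := (· ∈ S)) (D := D)
    (by rintro x rfl (rfl | rfl) <;> simp [hS]) (by rintro rfl x hx; simpa [hS] using hx) hD
  obtain ⟨i1, i2, i3⟩ := affected_run s (.node c l r) l r
    (splitVertex ⟨s, .node c l r⟩ ⟨s, l⟩ ⟨s, r⟩ M).1
    (splitVertex ⟨s, .node c l r⟩ ⟨s, l⟩ ⟨s, r⟩ M).2.1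
  have hlen : S.length ≤ D + 2 := by
    have := hD ⟨s, .node c l r⟩
    cases s
    · simp [hS]
    · rw [hS]
      simp only
      omega
  have hmem : ∀ x ∈ S, x ∈ (⟨s, l⟩ ::ₘ ⟨s, r⟩ ::ₘ H : Multiset (Vertex X)) ∧ x.side = .inA := by
    cases s
    · simp [hS]
    · intro x hx
      simp only [hS] at hx
      have hne := h.side_ne _ _ hx
      have hxH := (Multiset.mem_cons.1 (h.mem_of_mem_adj hx)).resolve_left
        fun e => hne (by rw [e])
      refine ⟨by simp [hxH], ?_⟩
      cases hs : x.side with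
      | inA => rfl
      | inB => exact absurd hs.symm hne
  obtain ⟨j1, j2⟩ := h2.forEach hB hH' hmem h3
  have hS' : (affected ⟨s, .node c l r⟩ ⟨s, l⟩ ⟨s, r⟩
      (splitVertex ⟨s, .node c l r⟩ ⟨s, l⟩ ⟨s, r⟩ M).1
      (splitVertex ⟨s, .node c l r⟩ ⟨s, l⟩ ⟨s, r⟩ M).2.1).1 = S := by
    rw [i1, h1, hS]
  simp only [iteration, Comp.bind_memory, Comp.bind_cost, i2, hS']
  refine ⟨j1, ?_⟩
  -- At most `D + 2` nodes are pruned. Each pruning is quadratic, since deleting one edge scans the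
  -- adjacency list at its other end.
  have j3 : ((3 * (D + 2) + 22) * (D + 2) + 13) * S.length ≤
      ((3 * (D + 2) + 22) * (D + 2) + 13) * (D + 2) := Nat.mul_le_mul_left _ hlen
  nlinarith [Nat.zero_le (D ^ 3), Nat.zero_le (D ^ 2)]

/-- The degree bound is not part of the invariant: it is derived anew from the geometry in each
iteration that passes the stopping test, with the current largest radius. -/
theorem mainLoop_run {X : Type u} [MetricSpace X] {d : ℝ} (hd : HalfRadiusCover X d)
    (hd0 : 0 ≤ d) {A B : Finset X} (hB : B.Nonempty) {p : Side → ℕ → X} {κ : ℝ} (hκ : 1 ≤ κ)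
    {ε : ℝ} (hε : 0 < ε) {D : ℕ} (hD : D = ⌊(16 * κ * (2 + 1 / ε)) ^ d⌋₊)
    {H : Multiset (Vertex X)} {zs : List (Vertex X)} (hzs : RadiusOrder H zs) {ρ : ℝ}
    (hH : HeapInv A B p κ ρ H) {M : Memory X}
    (h : GraphInv A B H (fun _ => False) (fun _ => False) M) :
    (∃ a ∈ A, ∀ b ∈ B, (mainLoop ε zs M).1 ≤ dist a b) ∧
    (∀ a ∈ A, ∃ b ∈ B, dist a b ≤ (1 + ε) * (mainLoop ε zs M).1) ∧
    (mainLoop ε zs M).2.2 ≤ 30 * (D + 2) ^ 3 * zs.length + 6 := by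
  induction hzs generalizing ρ M with
  | done H hzero =>
    have e : mainLoop ε [] M = (M.best, M, 2) := rfl
    rw [e]
    refine ⟨h.best_le, fun a ha => ?_, by simp⟩
    obtain ⟨b, hb, hab⟩ := h.exists_dist_le hH (r := 0) (fun v hv => (hzero v hv).le) ha
    refine ⟨b, hb, hab.trans ?_⟩
    have := mul_nonneg hε.le h.best_nonneg
    show M.best + 2 * 0 ≤ (1 + ε) * M.best
    linarith
  | pop H s c l r zs hpos hmax hzs ih =>
    have hr : ∀ v ∈ (⟨s, .node c l r⟩ ::ₘ H : Multiset (Vertex X)),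
        v.tree.radius ≤ (BallTree.node c l r).radius := fun v hv => by
      rcases Multiset.mem_cons.1 hv with rfl | hv
      · exact le_rfl
      · exact hmax v hv
    by_cases hfin : (BallTree.node c l r).radius ≤ ε * M.best / 2
    · rw [mainLoop_cons_finished (z := ⟨s, .node c l r⟩) hfin]
      refine ⟨h.best_le, fun a ha => ?_, Nat.le_add_left _ _⟩
      obtain ⟨b, hb, hab⟩ := h.exists_dist_le hH hr ha
      refine ⟨b, hb, hab.trans ?_⟩
      show _ ≤ (1 + ε) * M.best
      linarith
    · rw [not_le] at hfin
      have hlen : ∀ v, (M.adj v).length ≤ D := fun v => hD ▸ Nat.le_floor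
        (h.length_adj_le hd hd0 hκ hH hε ((BallTree.radius_nonneg _).lt_of_ne' hpos) hr
          (hH.radius_le (Multiset.mem_cons_self _ _)) hfin v)
      have hH' := hH.pop (by linarith) hmax
      obtain ⟨i1, i2⟩ := iteration_run hB hH hH' h hlen
      obtain ⟨e1, e2⟩ := mainLoop_cons_step (s := s) (zs := zs) hfin
      obtain ⟨j1, j2, j3⟩ := ih hH' i1
      rw [e1, e2, List.length_cons, mul_add_one]
      exact ⟨j1, j2, by linarith⟩

theorem program_run {X : Type u} [MetricSpace X] {α : ℝ} (hα : 1 < α) {d : ℝ}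
    (hd : HalfRadiusCover X d) (hd0 : 0 ≤ d) {A B : Finset X} (hA : A.Nonempty)
    (hB : B.Nonempty) {GA GB : BallTree X} (hGA : IsGreedyTree α A GA)
    (hGB : IsGreedyTree α B GB) {zs : List (Vertex X)}
    (hzs : RadiusOrder {⟨Side.inA, GA⟩, ⟨Side.inB, GB⟩} zs) {ε : ℝ} (hε : 0 < ε) {D : ℕ}
    (hD : D = ⌊(16 * (α ^ 3 / (α - 1)) * (2 + 1 / ε)) ^ d⌋₊) :
    (∃ a ∈ A, ∀ b ∈ B, output ε GA GB zs ≤ dist a b) ∧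
    (∀ a ∈ A, ∃ b ∈ B, dist a b ≤ (1 + ε) * output ε GA GB zs) ∧
    runningTime ε GA GB zs ≤ 30 * (D + 2) ^ 3 * (A.card + B.card) := by
  classical
  obtain ⟨p, ρ, hH⟩ := HeapInv.of_roots hα hGA hGB
  have hκ : 1 ≤ α ^ 3 / (α - 1) := by
    rw [le_div_iff₀ (by linarith)]
    nlinarith [sq_nonneg α, mul_pos (show 0 < α by linarith) (show 0 < α by linarith)]
  set x : Vertex X := ⟨Side.inA, GA⟩ with hx
  set y : Vertex X := ⟨Side.inB, GB⟩ with hy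
  have hxy : x ≠ y := fun e => by simp [hx, hy] at e
  set M : Memory X :=
    ⟨Function.update (Function.update (fun _ => []) x [y]) y [x], fun _ => 0, 0⟩ with hM
  have hadj : ∀ v, M.adj v = if v = y then [x] else if v = x then [y] else [] := fun v => by
    simp only [hM, Function.update_apply]
  have hadjx : M.adj x = [y] := by simp [hadj, hxy]
  have hmem : ∀ v w, w ∈ M.adj v ↔ (v = x ∧ w = y) ∨ (v = y ∧ w = x) := fun v w => by
    rw [hadj]
    split_ifs with h1 h2
    · subst h1
      simp [hxy.symm]
    · subst h2
      simp [hxy]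
    · simp [h1, h2]
  have hAside : ∀ v ∈ ({x, y} : Multiset (Vertex X)), v.side = .inA → v = x := by
    intro v hv hs
    rcases Multiset.mem_cons.1 hv with rfl | hv
    · rfl
    · rw [Multiset.mem_singleton] at hv
      subst hv
      simp [hy] at hs
  -- A single edge is trivially pruned; only the lower bound of the root is still missing, and
  -- `updateLow` supplies it.
  have h : GraphInv A B {x, y} (fun _ => False) (· = x) M := by
    refine ⟨?_, ?_, ?_, ?_, ?_, ?_, ?_, le_rfl, ?_⟩
    · intro v hv
      simp only [Multiset.insert_eq_cons, Multiset.mem_cons, Multiset.mem_singleton, not_or] at hv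
      simp [hadj, hv.1, hv.2]
    · intro v w
      rw [hmem, hmem]
      tauto
    · intro v w
      rw [hmem]
      rintro (⟨rfl, rfl⟩ | ⟨rfl, rfl⟩) <;> simp [hx, hy]
    · intro v
      rw [hadj]
      split_ifs <;> simp
    · intro v hv hs a ha b hb _
      rw [hAside v hv hs, hadjx]
      exact ⟨y, by simp, by rw [hy, hGB.leaves_eq]; exact hb⟩
    · intro v hv hs _ w hw w' hw'
      rw [hAside v hv hs, hadjx, List.mem_singleton] at hw hw'
      rw [hw, hw']
      linarith [v.tree.radius_nonneg, y.tree.radius_nonneg]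
    · intro v hv hs hne
      exact absurd (hAside v hv hs) hne
    · obtain ⟨a, ha⟩ := hA
      exact ⟨a, ha, fun _ _ => dist_nonneg⟩
  obtain ⟨i1, -, i3⟩ := h.updateLow hB hH (x := x) (V := fun _ => False)
    (by simp [Multiset.insert_eq_cons]) rfl (by simp)
  rw [hadjx] at i3
  obtain ⟨j1, j2, j3⟩ := mainLoop_run hd hd0 hB hκ hε hD hzs hH i1
  have hlen := hzs.length_add_card_le
  rw [hH.points] at hlen
  simp only [labelled, Multiset.card_add, Multiset.card_map, Finset.card_val,
    Multiset.insert_eq_cons, Multiset.card_cons, Multiset.card_singleton] at hlen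
  have e : runningTime ε GA GB zs = 1 + (1 + (1 + (1 + (1 + ((updateLow x M).2.2 +
      (mainLoop ε zs (updateLow x M).2.1).2.2))))) := rfl
  refine ⟨j1, j2, ?_⟩
  rw [e]
  -- Set-up, first update and loop exit take at most 24 steps. They are absorbed by the slack of two
  -- between the length of the list and the number of points.
  have hK : 30 ≤ 30 * (D + 2) ^ 3 := Nat.le_mul_of_pos_right _ (by positivity)
  have h1 : 30 * (D + 2) ^ 3 * (zs.length + 2) ≤ 30 * (D + 2) ^ 3 * (A.card + B.card) :=
    Nat.mul_le_mul_left _ hlen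
  simp only [List.length_singleton] at i3
  linarith

end Hausdorff

/-! ### The main theorem and the choice of the constant. -/

theorem theorem4p3 (α : ℝ) (hα : 1 < α) :
    ∃ C : ℝ, 0 < C ∧
      ∀ (X : Type u) [MetricSpace X] (d : ℝ), IsDoublingDimension X d →
      ∀ (A B : Finset X) (hA : A.Nonempty) (hB : B.Nonempty) (GA GB : BallTree X),
        IsGreedyTree α A GA → IsGreedyTree α B GB →
      ∀ zs : List (Vertex X), RadiusOrder {⟨Side.inA, GA⟩, ⟨Side.inB, GB⟩} zs →
      ∀ ε : ℝ, 0 < ε →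
        Hausdorff.output ε GA GB zs ≤ directedHausdorff A B hA hB ∧
        directedHausdorff A B hA hB ≤ (1 + ε) * Hausdorff.output ε GA GB zs ∧
        (Hausdorff.runningTime ε GA GB zs : ℝ) ≤
          C * (2 + 1 / ε) ^ (C * d) * ((A.card : ℝ) + (B.card : ℝ)) := by
  set κ := α ^ 3 / (α - 1) with hκ
  have hκ0 : 0 < κ := div_pos (by positivity) (by linarith)
  -- Since `2 + 1 / ε ≥ 2`, the factor `16 * κ < 2 ^ k` can be moved into the exponent, which
  -- becomes `(k + 1) * d`.
  obtain ⟨k, hk⟩ := pow_unbounded_of_one_lt (16 * κ) (one_lt_two : (1 : ℝ) < 2)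
  refine ⟨3 * k + 810, by positivity, ?_⟩
  intro X _ d hd A B hA hB GA GB hGA hGB zs hzs ε hε
  have : Nonempty X := ⟨hA.choose⟩
  have hd0 := hd.1.nonneg
  obtain ⟨⟨a, ha, hlow⟩, hup, htime⟩ :=
    Hausdorff.program_run hα hd.1 hd0 hA hB hGA hGB hzs hε rfl
  rw [← hκ] at htime
  refine ⟨?_, ?_, ?_⟩
  · exact (Finset.le_inf' hB _ hlow).trans (Finset.le_sup' (fun a => B.inf' hB fun b => dist a b) ha)
  · refine Finset.sup'_le hA _ fun a ha => ?_
    obtain ⟨b, hb, hab⟩ := hup a ha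
    exact (Finset.inf'_le _ hb).trans hab
  · set u := 2 + 1 / ε with hu
    have hu2 : 2 ≤ u := by
      have : 0 < 1 / ε := by positivity
      linarith
    have hu0 : 0 < u := by linarith
    set F := (16 * κ * u) ^ d with hF
    have hF0 : 0 ≤ F := by positivity
    have hFle : F ≤ u ^ ((k + 1 : ℝ) * d) := by
      rw [Real.rpow_mul hu0.le]
      refine Real.rpow_le_rpow (by positivity) ?_ hd0
      rw [Real.rpow_add_one hu0.ne', Real.rpow_natCast]
      gcongr
      exact hk.le.trans (by gcongr)
    have hone : 1 ≤ u ^ ((k + 1 : ℝ) * d) :=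
      Real.one_le_rpow (by linarith) (by positivity)
    -- Cubing needs the exponent `(3 * k + 3) * d`, and `30 * 27 = 810` is the leading factor; `3 *
    -- k + 810` dominates both.
    have hcube : (F + 2) ^ 3 ≤ 27 * u ^ ((3 * k + 810 : ℝ) * d) := by
      calc (F + 2) ^ 3 ≤ (3 * u ^ ((k + 1 : ℝ) * d)) ^ 3 := by gcongr; linarith
        _ = 27 * u ^ ((k + 1 : ℝ) * d * 3) := by
            rw [mul_pow, ← Real.rpow_natCast (u ^ _) 3, ← Real.rpow_mul hu0.le]
            norm_num
        _ ≤ 27 * u ^ ((3 * k + 810 : ℝ) * d) := by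
            refine mul_le_mul_of_nonneg_left
              (Real.rpow_le_rpow_of_exponent_le (by linarith) ?_) (by norm_num)
            nlinarith
    calc (Hausdorff.runningTime ε GA GB zs : ℝ)
        ≤ 30 * ((⌊F⌋₊ : ℝ) + 2) ^ 3 * (A.card + B.card) := by exact_mod_cast htime
      _ ≤ 30 * (F + 2) ^ 3 * (A.card + B.card) := by
          gcongr
          exact Nat.floor_le hF0
      _ ≤ 30 * (27 * u ^ ((3 * k + 810 : ℝ) * d)) * (A.card + B.card) := by gcongr
      _ = 810 * u ^ ((3 * k + 810 : ℝ) * d) * (A.card + B.card) := by ring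
      _ ≤ _ := by
          gcongr
          linarith [(Nat.cast_nonneg k : (0 : ℝ) ≤ k)]
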